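/- Let $E_{10}$ be the split real Kac--Moody algebra given by the Chevalley--Serre presentation with generators $e_i,f_i,h_i$ ($1\le i\le 10$) and the Cartan matrix $A$ whose Dynkin diagram is the line $1-2-\cdots-9$ with the node $10$ joined to the node $7$. Let $\omega$ be the Cartan--Chevalley involution, $\omega(e_i)=-f_i$, $\omega(f_i)=-e_i$, $\omega(h_i)=-h_i$, let $K(E_{10})=\{x\in E_{10}\mid \omega(x)=x\}$, and put $x_i=e_i-f_i\in K(E_{10})$. Let $G^{ab}=\delta^{ab}-\tfrac19$ ($1\le a,b\le 10$), with inverse matrix $G_{ab}=\delta_{ab}-1$. Write the simple roots as covectors $\alpha=(p_1,\dots,p_{10})$: $\alpha_i$ has $p_i=1$, $p_{i+1}=-1$ and zeros elsewhere for $1\le i\le 9$, and $\alpha_{10}=(0,\dots,0,1,1,1)$; then $\sum_{a,b}G^{ab}(\alpha_i)_a(\alpha_j)_b=A_{ij}$. There exist real symmetric $32\times32$ matrices $\Gamma_1,\dots,\Gamma_{10}$ with $\Gamma_a\Gamma_b+\Gamma_b\Gamma_a=2\delta_{ab}$. For any such matrices put $$\Gamma(\alpha)=\Gamma_1^{p_1}\cdots\Gamma_{10}^{p_{10}},\qquad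 X(\alpha)^a{}_b=-\tfrac12\alpha^a\alpha_b+\tfrac14\delta^a_b,\qquad J(\alpha)=-2\,X(\alpha)\otimes\Gamma(\alpha),$$ where $\alpha_a=p_a$ and $\alpha^a=\sum_c G^{ac}\alpha_c$. Then there is a unique Lie algebra homomorphism $\rho$ from $K(E_{10})$ to the real matrices acting on $\mathbb R^{10}\otimes\mathbb R^{32}$ with $\rho(x_i)=J(\alpha_i)$ for $i=1,\dots,10$ (the spin-$\tfrac32$ representation). The symmetric bilinear form $$(\phi,\psi)=\sum_{a,b=1}^{10}\sum_{s=1}^{32}\phi^a_s\,G_{ab}\,\psi^b_s$$ has signature $(288,32)$ and is invariant: $(\rho(y)\phi,\psi)+(\phi,\rho(y)\psi)=0$ for all $y\in K(E_{10})$. The image of $\rho$ consists of all matrices $M$ with $(M\phi,\psi)+(\phi,M\psi)=0$ for all $\phi,\psi$. Consequently, as real Lie algebras, $$\mathfrak q_{3/2}(K(E_{10})):=K(E_{10})/\ker\rho\;\cong\;\mathfrak{so}(288,32),$$ and this quotient is non-compact: it carries no invariant negative definite symmetric bilinear form. -/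

import Mathlib

open scoped Matrix Kronecker

attribute [local instance 100] LieRing.ofAssociativeRing

noncomputable section

namespace KacMoody

open CartanMatrix

/-! ### Split real Kac–Moody algebras and their involutory subalgebras -/

variable {B : Type} [DecidableEq B]

/-- The quotient map from the free Lie algebra on the Chevalley generators to the real Lie algebra
with the Chevalley–Serre presentation attached to `A`. -/
def mkHom (A : Matrix B B ℤ) : FreeLieAlgebra ℝ (Generators B) →ₗ⁅ℝ⁆ A.ToLieAlgebra ℝ where
  toLinearMap := (Relations.toIdeal ℝ A).toSubmodule.mkQ
  map_lie' := rfl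

/-- Chevalley generator `e i`. -/
def e (A : Matrix B B ℤ) (i : B) : A.ToLieAlgebra ℝ := mkHom A (FreeLieAlgebra.of ℝ (Generators.E i))

/-- Chevalley generator `f i`. -/
def f (A : Matrix B B ℤ) (i : B) : A.ToLieAlgebra ℝ := mkHom A (FreeLieAlgebra.of ℝ (Generators.F i))

/-- Chevalley generator `h i`. -/
def h (A : Matrix B B ℤ) (i : B) : A.ToLieAlgebra ℝ := mkHom A (FreeLieAlgebra.of ℝ (Generators.H i))

theorem mkHom_eq_zero {A : Matrix B B ℤ} {x : FreeLieAlgebra ℝ (Generators B)}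
    (hx : x ∈ Relations.toSet ℝ A) : mkHom A x = 0 :=
  (Submodule.Quotient.mk_eq_zero _).2 (LieSubmodule.subset_lieSpan hx)

theorem lie_h_h (A : Matrix B B ℤ) (i j : B) : ⁅h A i, h A j⁆ = 0 := by
  have := mkHom_eq_zero (A := A) (x := Relations.HH ℝ (i, j)) (by simp [Relations.toSet])
  simpa [Relations.HH, h] using this

theorem lie_e_f (A : Matrix B B ℤ) (i j : B) :
    ⁅e A i, f A j⁆ = if i = j then h A i else 0 := by
  have := mkHom_eq_zero (A := A) (x := Relations.EF ℝ (i, j)) (by simp [Relations.toSet])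
  by_cases hij : i = j
  · subst hij
    simpa [Relations.EF, h, e, f, sub_eq_zero] using this
  · simpa [Relations.EF, h, e, f, hij] using this

theorem lie_h_e (A : Matrix B B ℤ) (i j : B) : ⁅h A i, e A j⁆ = A i j • e A j := by
  have := mkHom_eq_zero (A := A) (x := Relations.HE ℝ A (i, j)) (by simp [Relations.toSet])
  simpa [Relations.HE, h, e, sub_eq_zero] using this

theorem lie_h_f (A : Matrix B B ℤ) (i j : B) : ⁅h A i, f A j⁆ = -(A i j • f A j) := by
  have := mkHom_eq_zero (A := A) (x := Relations.HF ℝ A (i, j)) (by simp [Relations.toSet])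
  simpa [Relations.HF, h, f, add_eq_zero_iff_eq_neg] using this

theorem map_ad_pow {L L' : Type*} [LieRing L] [LieAlgebra ℝ L] [LieRing L'] [LieAlgebra ℝ L']
    (φ : L →ₗ⁅ℝ⁆ L') (x y : L) (n : ℕ) :
    φ ((LieAlgebra.ad ℝ L x ^ n) y) = (LieAlgebra.ad ℝ L' (φ x) ^ n) (φ y) := by
  induction n with
  | zero => simp
  | succ n ih => simp only [pow_succ', Module.End.mul_apply, LieAlgebra.ad_apply, LieHom.map_lie, ih]

theorem serre_e (A : Matrix B B ℤ) (i j : B) :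
    (LieAlgebra.ad ℝ (A.ToLieAlgebra ℝ) (e A i) ^ (-A i j).toNat) ⁅e A i, e A j⁆ = 0 := by
  have := mkHom_eq_zero (A := A) (x := Relations.adE ℝ A (i, j)) (by simp [Relations.toSet])
  simpa [Relations.adE, e, map_ad_pow] using this

theorem serre_f (A : Matrix B B ℤ) (i j : B) :
    (LieAlgebra.ad ℝ (A.ToLieAlgebra ℝ) (f A i) ^ (-A i j).toNat) ⁅f A i, f A j⁆ = 0 := by
  have := mkHom_eq_zero (A := A) (x := Relations.adF ℝ A (i, j)) (by simp [Relations.toSet])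
  simpa [Relations.adF, f, map_ad_pow] using this

/-- The Cartan–Chevalley involution on the free Lie algebra, with values in the quotient. -/
def freeInvolution (A : Matrix B B ℤ) :
    FreeLieAlgebra ℝ (Generators B) →ₗ⁅ℝ⁆ A.ToLieAlgebra ℝ :=
  FreeLieAlgebra.lift ℝ fun g => match g with
    | Generators.H i => -h A i
    | Generators.E i => -f A i
    | Generators.F i => -e A i

theorem ad_neg_pow_eq_zero {L : Type*} [LieRing L] [LieAlgebra ℝ L] {x y : L} {n : ℕ}
    (hxy : (LieAlgebra.ad ℝ L x ^ n) y = 0) : (LieAlgebra.ad ℝ L (-x) ^ n) y = 0 := by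
  rw [map_neg, neg_pow]
  rcases neg_one_pow_eq_or (Module.End ℝ L) n with h1 | h1 <;> simp [h1, hxy]

theorem toIdeal_le_ker (A : Matrix B B ℤ) :
    Relations.toIdeal ℝ A ≤ (freeInvolution A).ker := by
  refine LieSubmodule.lieSpan_le.2 ?_
  have hfe : ∀ i j, ⁅f A i, e A j⁆ = -(if j = i then h A j else 0) := fun i j => by
    rw [← lie_skew, lie_e_f]
  rintro x (((((⟨⟨i, j⟩, rfl⟩ | ⟨⟨i, j⟩, rfl⟩) | ⟨⟨i, j⟩, rfl⟩) | ⟨⟨i, j⟩, rfl⟩) | ⟨⟨i, j⟩, rfl⟩) |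
    ⟨⟨i, j⟩, rfl⟩) <;> simp only [SetLike.mem_coe, LieHom.mem_ker]
  · simp [Relations.HH, freeInvolution, lie_h_h]
  · by_cases hij : i = j
    · subst hij
      simp [Relations.EF, freeInvolution, hfe]
    · simp [Relations.EF, freeInvolution, hfe, hij, Ne.symm hij]
  · simp [Relations.HE, freeInvolution, lie_h_f]
  · simp [Relations.HF, freeInvolution, lie_h_e]
  · simpa [Relations.adE, freeInvolution, map_ad_pow] using ad_neg_pow_eq_zero (serre_f A i j)
  · simpa [Relations.adF, freeInvolution, map_ad_pow] using ad_neg_pow_eq_zero (serre_e A i j)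

/-- The Cartan–Chevalley involution: the Lie algebra endomorphism with
`e i ↦ -f i`, `f i ↦ -e i`, `h i ↦ -h i`. -/
def involution (A : Matrix B B ℤ) : A.ToLieAlgebra ℝ →ₗ⁅ℝ⁆ A.ToLieAlgebra ℝ where
  toLinearMap := (Relations.toIdeal ℝ A).toSubmodule.liftQ (freeInvolution A).toLinearMap
    fun _ hx => toIdeal_le_ker A hx
  map_lie' := by
    intro x y
    obtain ⟨x, rfl⟩ := Submodule.mkQ_surjective _ x
    obtain ⟨y, rfl⟩ := Submodule.mkQ_surjective _ y
    exact LieHom.map_lie (freeInvolution A) x y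

theorem involution_mkHom (A : Matrix B B ℤ) (x : FreeLieAlgebra ℝ (Generators B)) :
    involution A (mkHom A x) = freeInvolution A x := rfl

theorem involution_e (A : Matrix B B ℤ) (i : B) : involution A (e A i) = -f A i := by
  rw [e, involution_mkHom, freeInvolution, FreeLieAlgebra.lift_of_apply]

theorem involution_f (A : Matrix B B ℤ) (i : B) : involution A (f A i) = -e A i := by
  rw [f, involution_mkHom, freeInvolution, FreeLieAlgebra.lift_of_apply]

theorem involution_h (A : Matrix B B ℤ) (i : B) : involution A (h A i) = -h A i := by
  change freeInvolution A (FreeLieAlgebra.of ℝ (Generators.H i)) = -h A i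
  rw [freeInvolution, FreeLieAlgebra.lift_of_apply]

/-- The involutory ("maximal compact") subalgebra `K(𝔤)`: the fixed points of the
Cartan–Chevalley involution. -/
def involutorySubalgebra (A : Matrix B B ℤ) : LieSubalgebra ℝ (A.ToLieAlgebra ℝ) where
  carrier := {x | involution A x = x}
  add_mem' := by intro x y hx hy; simp_all
  zero_mem' := by simp
  smul_mem' := by intro c x hx; simp_all
  lie_mem' := by intro x y hx hy; simp_all

/-- The element `x i = e i - f i` of `K(𝔤)`. -/
def compactGenerator (A : Matrix B B ℤ) (i : B) : involutorySubalgebra A :=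
  ⟨e A i - f A i, by
    change involution A (e A i - f A i) = e A i - f A i
    rw [map_sub, involution_e, involution_f]; abel⟩

end KacMoody

namespace E10

/-! ### The algebra `E₁₀` and its involutory subalgebra -/

/-- The Cartan matrix of `E₁₀`. The first nine nodes form a line and the tenth node is attached to
the seventh one. -/
def cartanMatrix : Matrix (Fin 10) (Fin 10) ℤ :=
  !![ 2, -1,  0,  0,  0,  0,  0,  0,  0,  0;
     -1,  2, -1,  0,  0,  0,  0,  0,  0,  0;
      0, -1,  2, -1,  0,  0,  0,  0,  0,  0;
      0,  0, -1,  2, -1,  0,  0,  0,  0,  0;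
      0,  0,  0, -1,  2, -1,  0,  0,  0,  0;
      0,  0,  0,  0, -1,  2, -1,  0,  0,  0;
      0,  0,  0,  0,  0, -1,  2, -1,  0, -1;
      0,  0,  0,  0,  0,  0, -1,  2, -1,  0;
      0,  0,  0,  0,  0,  0,  0, -1,  2,  0;
      0,  0,  0,  0,  0,  0, -1,  0,  0,  2]

/-- `K(E₁₀)`, a subalgebra of the split real Kac–Moody algebra `E₁₀`. -/
abbrev K : LieSubalgebra ℝ (cartanMatrix.ToLieAlgebra ℝ) :=
  KacMoody.involutorySubalgebra cartanMatrix

/-- The generators `x i = e i - f i` of `K(E₁₀)`. -/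
abbrev x (i : Fin 10) : K := KacMoody.compactGenerator cartanMatrix i

/-- The simple roots of `E₁₀`, written in the wall basis. -/
def simpleRoot : Fin 10 → Fin 10 → ℤ :=
  ![![1, -1, 0, 0, 0, 0, 0, 0, 0, 0],
    ![0, 1, -1, 0, 0, 0, 0, 0, 0, 0],
    ![0, 0, 1, -1, 0, 0, 0, 0, 0, 0],
    ![0, 0, 0, 1, -1, 0, 0, 0, 0, 0],
    ![0, 0, 0, 0, 1, -1, 0, 0, 0, 0],
    ![0, 0, 0, 0, 0, 1, -1, 0, 0, 0],
    ![0, 0, 0, 0, 0, 0, 1, -1, 0, 0],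
    ![0, 0, 0, 0, 0, 0, 0, 1, -1, 0],
    ![0, 0, 0, 0, 0, 0, 0, 0, 1, -1],
    ![0, 0, 0, 0, 0, 0, 0, 1, 1, 1]]

/-- The DeWitt metric `G^{ab} = δ^{ab} - 1/9` on the dual of the Cartan subalgebra. -/
def metric : Matrix (Fin 10) (Fin 10) ℝ :=
  Matrix.of fun a b => (if a = b then 1 else 0) - 1 / 9

/-- The inverse DeWitt metric `G_{ab}`. -/
def metricLower : Matrix (Fin 10) (Fin 10) ℝ :=
  Matrix.of fun a b => (if a = b then 1 else 0) - 1

theorem metric_mul_metricLower : metric * metricLower = 1 := by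
  ext a b
  simp only [metric, metricLower, Matrix.mul_apply, Matrix.of_apply, Matrix.one_apply, sub_mul,
    mul_sub, Finset.sum_sub_distrib]
  simp
  ring

/-! ### The spin-3/2 representation -/

/-- Real symmetric `32 × 32` gamma matrices of the ten-dimensional Euclidean Clifford algebra,
`{Γ_a, Γ_b} = 2 δ_{ab}`. -/
structure IsGammaSystem (Γ : Fin 10 → Matrix (Fin 32) (Fin 32) ℝ) : Prop where
  anticomm : ∀ a b, Γ a * Γ b + Γ b * Γ a = if a = b then 2 else 0
  symm : ∀ a, (Γ a)ᵀ = Γ a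

/-- `Γ(α) = Γ_1 ^ p_1 ⋯ Γ_10 ^ p_10` for `α = (p_1, …, p_10)` in the wall basis. -/
def gammaOf (Γ : Fin 10 → Matrix (Fin 32) (Fin 32) ℝ) (α : Fin 10 → ℤ) :
    Matrix (Fin 32) (Fin 32) ℝ :=
  (List.ofFn fun a => Γ a ^ α a).prod

/-- The polarisation tensor `X(α)^a_b = -(1/2) α^a α_b + (1/4) δ^a_b`, where
`α^a = ∑_c G^{ac} α_c`. -/
def polarisation (α : Fin 10 → ℤ) : Matrix (Fin 10) (Fin 10) ℝ :=
  Matrix.of fun a b =>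
    -(1 / 2) * (∑ c, metric a c * (α c : ℝ)) * (α b : ℝ) + (1 / 4) * (if a = b then 1 else 0)

/-- `J(α) = -2 X(α) ⊗ Γ(α)`, acting on the vector-spinors `φ^a_s`. -/
def spinGenerator (Γ : Fin 10 → Matrix (Fin 32) (Fin 32) ℝ) (α : Fin 10 → ℤ) :
    Matrix (Fin 10 × Fin 32) (Fin 10 × Fin 32) ℝ :=
  (-2 : ℝ) • (polarisation α ⊗ₖ gammaOf Γ α)

/-- `ρ` is the spin-3/2 representation of `K(E₁₀)`: it sends `x i` to `J(α_i)` for every simple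
root `α_i`. -/
def IsSpinThreeHalves (Γ : Fin 10 → Matrix (Fin 32) (Fin 32) ℝ)
    (ρ : K →ₗ⁅ℝ⁆ Matrix (Fin 10 × Fin 32) (Fin 10 × Fin 32) ℝ) : Prop :=
  ∀ i, ρ (x i) = spinGenerator Γ (simpleRoot i)

/-- The Gram matrix `η = G_{ab} δ_{st}` on vector-spinors. -/
def gram : Matrix (Fin 10 × Fin 32) (Fin 10 × Fin 32) ℝ :=
  metricLower ⊗ₖ (1 : Matrix (Fin 32) (Fin 32) ℝ)

/-- The symmetric bilinear form `(φ, ψ) = ∑ φ^a_s G_{ab} ψ^b_s` on vector-spinors. -/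
def form : LinearMap.BilinForm ℝ (Fin 10 × Fin 32 → ℝ) := Matrix.toBilin' gram

end E10

/-- The real Lie algebra `L` carries an invariant negative definite symmetric bilinear form. A
finite-dimensional real Lie algebra is compact exactly when it has this property. -/
def HasInvariantNegDefForm (L : Type*) [LieRing L] [LieAlgebra ℝ L] : Prop :=
  ∃ β : LinearMap.BilinForm ℝ L, (∀ y z, β y z = β z y) ∧
    (∀ w y z : L, β ⁅w, y⁆ z + β y ⁅w, z⁆ = 0) ∧ ∀ y : L, y ≠ 0 → β y y < 0

end

noncomputable section

/-! ### Generation of the involutory subalgebra by the elements `e i - f i`. -/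

namespace KacMoody

variable {B : Type} [DecidableEq B] (A : Matrix B B ℤ)

/-! Existence and uniqueness of `ρ` amount to a presentation of `K` by the elements `x i`. They
generate (`lieSpan_compactGenerator`): by induction on height, `y + ω y` lies in the subalgebra they
generate, and it equals `2 y` when `y` is fixed by `ω`. Berman's relations between them suffice to
define a representation (`exists_involutorySubalgebra_rep`). Heuristically, `𝔤 = 𝔟 + K` for the
Borel subalgebra `𝔟`, so the module induced from a `K`-module `V` should be `U(𝔟) ⊗ V`. The action
of `𝔤` on this space is written down directly from operators `R i` satisfying Berman's relations.
The Serre relations of the `f i` hold because a Serre element commutes with every `e k`, is an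
eigenvector for the `h k`, and vanishes on `1 ⊗ V` by Berman's relations. Then `K` preserves `1 ⊗
V`, and its action there is the required representation.

For the matrices `J(α_i)`, Berman's relations follow from two facts (`isBerman_spinGenerator`):
gamma words commute or anticommute according to the parity of the Cartan entry, and polarisations of
covectors of inner product `-1` satisfy `{X(u), X(v)} = ½ X(u + v)`.

The image preserves the form because each `J(α_i)` is a self-adjoint polarisation tensored with an
antisymmetric word. Conversely, adding roots puts `X(α) ⊗ Γ(α)` in the image for the roots `ε_a -
ε_b`, sums of three or six distinct `ε`, and sums of seven distinct `ε` plus twice another. Two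
roots of the last kind can share a gamma word, and their bracket is `(u ∧ v) ⊗ 1`. Such brackets
span `so(9,1) ⊗ 1` (`wedge_mem`). Under this algebra, a single polarisation generates all symmetric
coefficients of its word (`symProd_mem_coefficients`). The antisymmetric words span the
antisymmetric `32 × 32` matrices, so the image contains symmetric ⊗ antisymmetric. Brackets of these
yield antisymmetric ⊗ symmetric, which completes the orthogonal Lie algebra (`skewAdjoint_le`).

An orthonormal frame gives the signature and the identification with `so(288,32)`. Non-compactness
is witnessed inside `so(9,1) ⊗ 1` by a boost with a nonzero eigenvector of eigenvalue `1` in its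
adjoint action (`exists_hyperbolic`). -/

theorem mkHom_surjective : Function.Surjective (mkHom A) :=
  Submodule.mkQ_surjective _

theorem eq_top_of_generators {S : LieSubalgebra ℝ (A.ToLieAlgebra ℝ)}
    (he : ∀ i, e A i ∈ S) (hf : ∀ i, f A i ∈ S) (hh : ∀ i, h A i ∈ S) : S = ⊤ := by
  let g : CartanMatrix.Generators B → S := fun t => match t with
    | .H i => ⟨h A i, hh i⟩
    | .E i => ⟨e A i, he i⟩
    | .F i => ⟨f A i, hf i⟩
  have key : S.incl.comp (FreeLieAlgebra.lift ℝ g) = mkHom A := by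
    ext t
    rcases t with i | i | i <;> simp [g, h, e, f]
  refine eq_top_iff.2 fun y _ => ?_
  obtain ⟨y, rfl⟩ := mkHom_surjective A y
  rw [← key]
  exact (FreeLieAlgebra.lift ℝ g y).2

/-- The elements of a Lie algebra whose adjoint action preserves a given subspace. -/
def adStabilizer {L : Type*} [LieRing L] [LieAlgebra ℝ L] (N : Submodule ℝ L) :
    LieSubalgebra ℝ L where
  carrier := {y | ∀ z ∈ N, ⁅y, z⁆ ∈ N}
  add_mem' := by
    intro a b ha hb z hz
    rw [add_lie]
    exact N.add_mem (ha z hz) (hb z hz)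
  zero_mem' := by intro z _; simp
  smul_mem' := by
    intro c a ha z hz
    rw [smul_lie]
    exact N.smul_mem c (ha z hz)
  lie_mem' := by
    intro a b ha hb z hz
    rw [lie_lie]
    exact N.sub_mem (ha _ (hb z hz)) (hb _ (ha z hz))

/-- The stabiliser of `N` under the adjoint action is a subalgebra, so it is everything once it
contains the generators. Then `N` is itself closed under brackets and contains the generators. -/
theorem submodule_eq_top_of_generators {N : Submodule ℝ (A.ToLieAlgebra ℝ)}
    (he : ∀ i, e A i ∈ N) (hf : ∀ i, f A i ∈ N) (hh : ∀ i, h A i ∈ N)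
    (he' : ∀ i, ∀ z ∈ N, ⁅e A i, z⁆ ∈ N) (hf' : ∀ i, ∀ z ∈ N, ⁅f A i, z⁆ ∈ N)
    (hh' : ∀ i, ∀ z ∈ N, ⁅h A i, z⁆ ∈ N) : N = ⊤ := by
  have h1 : adStabilizer N = ⊤ := eq_top_of_generators A he' hf' hh'
  let S : LieSubalgebra ℝ (A.ToLieAlgebra ℝ) :=
    { N with
      lie_mem' := by
        intro a b _ hb
        have : a ∈ adStabilizer N := h1 ▸ LieSubalgebra.mem_top a
        exact this b hb }
  have h2 : S = ⊤ := eq_top_of_generators A he hf hh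
  refine eq_top_iff.2 fun y _ => ?_
  have : y ∈ S := h2 ▸ LieSubalgebra.mem_top y
  exact this

theorem involution_involution (y : A.ToLieAlgebra ℝ) : involution A (involution A y) = y := by
  have key : ((involution A).comp (involution A)).comp (mkHom A) = mkHom A := by
    ext t
    rcases t with i | i | i
    · change involution A (involution A (h A i)) = h A i
      simp [involution_h]
    · change involution A (involution A (e A i)) = e A i
      simp [involution_e, involution_f]
    · change involution A (involution A (f A i)) = f A i
      simp [involution_e, involution_f]
  obtain ⟨y, rfl⟩ := mkHom_surjective A y
  exact LieHom.congr_fun key y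

theorem lie_f_e (i j : B) : ⁅f A i, e A j⁆ = -(if j = i then h A j else 0) := by
  rw [← lie_skew, lie_e_f]

/-- The elements of height at most `n` of the Borel subalgebra. -/
def borelFiltration : ℕ → Submodule ℝ (A.ToLieAlgebra ℝ)
  | 0 => Submodule.span ℝ (Set.range (h A))
  | n + 1 => borelFiltration n ⊔ Submodule.span ℝ (Set.range (e A)) ⊔
      ⨆ i, (borelFiltration n).map (LieAlgebra.ad ℝ (A.ToLieAlgebra ℝ) (e A i))

theorem borelFiltration_le_succ (n : ℕ) : borelFiltration A n ≤ borelFiltration A (n + 1) :=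
  le_sup_left.trans le_sup_left

theorem borelFiltration_mono : Monotone (borelFiltration A) :=
  monotone_nat_of_le_succ (borelFiltration_le_succ A)

theorem h_mem_borelFiltration (n : ℕ) (i : B) : h A i ∈ borelFiltration A n :=
  borelFiltration_mono A (Nat.zero_le n) (Submodule.subset_span ⟨i, rfl⟩)

theorem e_mem_borelFiltration (n : ℕ) (i : B) : e A i ∈ borelFiltration A (n + 1) :=
  (le_sup_right.trans le_sup_left : _ ≤ borelFiltration A (n + 1)) (Submodule.subset_span ⟨i, rfl⟩)

theorem lie_e_mem_borelFiltration {n : ℕ} (i : B) {z : A.ToLieAlgebra ℝ}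
    (hz : z ∈ borelFiltration A n) : ⁅e A i, z⁆ ∈ borelFiltration A (n + 1) :=
  ((le_iSup (fun i => (borelFiltration A n).map (LieAlgebra.ad ℝ (A.ToLieAlgebra ℝ) (e A i)))
    i).trans le_sup_right : _ ≤ borelFiltration A (n + 1)) ⟨z, hz, rfl⟩

theorem borelFiltration_succ_le {n : ℕ} {N : Submodule ℝ (A.ToLieAlgebra ℝ)}
    (h0 : borelFiltration A n ≤ N) (h1 : ∀ i, e A i ∈ N)
    (h2 : ∀ i, ∀ z ∈ borelFiltration A n, ⁅e A i, z⁆ ∈ N) : borelFiltration A (n + 1) ≤ N := by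
  refine sup_le (sup_le h0 (Submodule.span_le.2 ?_)) (iSup_le fun i => ?_)
  · rintro _ ⟨i, rfl⟩
    exact h1 i
  · rintro _ ⟨z, hz, rfl⟩
    exact h2 i z hz

theorem lie_h_mem_borelFiltration (n : ℕ) (i : B) {z : A.ToLieAlgebra ℝ}
    (hz : z ∈ borelFiltration A n) : ⁅h A i, z⁆ ∈ borelFiltration A n := by
  suffices borelFiltration A n ≤
      (borelFiltration A n).comap (LieAlgebra.ad ℝ (A.ToLieAlgebra ℝ) (h A i)) from this hz
  clear hz
  induction n with
  | zero =>
    refine Submodule.span_le.2 ?_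
    rintro _ ⟨j, rfl⟩
    simp [lie_h_h]
  | succ n ih =>
    refine borelFiltration_succ_le A
      (ih.trans (Submodule.comap_mono (borelFiltration_le_succ A n))) (fun j => ?_)
      fun j z hz => ?_
    · rw [Submodule.mem_comap, LieAlgebra.ad_apply, lie_h_e]
      exact zsmul_mem (e_mem_borelFiltration A n j) _
    · rw [Submodule.mem_comap, LieAlgebra.ad_apply, leibniz_lie, lie_h_e, zsmul_lie]
      exact add_mem (zsmul_mem (lie_e_mem_borelFiltration A j hz) _)
        (lie_e_mem_borelFiltration A j (ih hz))

/-- Bracketing with `f i` lowers height by one. The span of the `f` is needed because `⁅f i, h j⁆`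
is a multiple of `f i`; at height zero the truncated `n - 1` is harmless. -/
theorem lie_f_mem_borelFiltration (n : ℕ) (i : B) {z : A.ToLieAlgebra ℝ}
    (hz : z ∈ borelFiltration A n) :
    ⁅f A i, z⁆ ∈ borelFiltration A (n - 1) ⊔ Submodule.span ℝ (Set.range (f A)) := by
  suffices borelFiltration A n ≤
      (borelFiltration A (n - 1) ⊔ Submodule.span ℝ (Set.range (f A))).comap
        (LieAlgebra.ad ℝ (A.ToLieAlgebra ℝ) (f A i)) from this hz
  clear hz
  have h0 : borelFiltration A 0 ≤ (Submodule.span ℝ (Set.range (f A))).comap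
      (LieAlgebra.ad ℝ (A.ToLieAlgebra ℝ) (f A i)) := by
    refine Submodule.span_le.2 ?_
    rintro _ ⟨j, rfl⟩
    rw [SetLike.mem_coe, Submodule.mem_comap, LieAlgebra.ad_apply, ← lie_skew, lie_h_f, neg_neg]
    exact zsmul_mem (Submodule.subset_span (Set.mem_range_self i)) _
  have hfe : ∀ n j, ⁅f A i, e A j⁆ ∈ borelFiltration A n := fun n j => by
    rw [lie_f_e]
    split_ifs
    · exact neg_mem (h_mem_borelFiltration A n j)
    · simp
  induction n with
  | zero => exact h0.trans (Submodule.comap_mono le_sup_right)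
  | succ n ih =>
    refine borelFiltration_succ_le A
      (ih.trans (Submodule.comap_mono
        (sup_le_sup_right (borelFiltration_mono A (by lia)) _)))
      (fun j => ?_) fun j z hz => ?_
    · exact Submodule.mem_sup_left (hfe _ j)
    · rw [Submodule.mem_comap, LieAlgebra.ad_apply, leibniz_lie, Nat.add_sub_cancel]
      refine Submodule.mem_sup_left (add_mem ?_ ?_)
      · rw [lie_f_e]
        split_ifs
        · rw [neg_lie]
          exact neg_mem (lie_h_mem_borelFiltration A n j hz)
        · simp
      · have hef : ∀ n, Submodule.span ℝ (Set.range (f A)) ≤ (borelFiltration A n).comap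
            (LieAlgebra.ad ℝ (A.ToLieAlgebra ℝ) (e A j)) := fun n => by
          refine Submodule.span_le.2 ?_
          rintro _ ⟨k, rfl⟩
          rw [SetLike.mem_coe, Submodule.mem_comap, LieAlgebra.ad_apply, lie_e_f]
          split_ifs
          · exact h_mem_borelFiltration A n _
          · simp
        -- At `n = 0` the induction hypothesis is too weak, since `0 - 1 = 0` would allow `⁅e j, ·⁆`
        -- to reach height one. The sharper `h0` places the inner bracket in the span of the `f`.
        rcases n with _ | n
        · exact hef 0 (h0 hz)
        · obtain ⟨a, ha, b, hb, hab⟩ := Submodule.mem_sup.1 (ih hz)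
          rw [LieAlgebra.ad_apply] at hab
          rw [← hab, lie_add]
          exact add_mem (lie_e_mem_borelFiltration A j ha) (hef (n + 1) hb)

/-- The span of the Borel subalgebra and of its image under the Cartan–Chevalley involution
is everything. -/
theorem iSup_borelFiltration_sup_map_involution :
    (⨆ n, borelFiltration A n) ⊔ (⨆ n, borelFiltration A n).map
      (involution A : A.ToLieAlgebra ℝ →ₗ[ℝ] A.ToLieAlgebra ℝ) = ⊤ := by
  set W := ⨆ n, borelFiltration A n with hW
  set V := W.map (involution A : A.ToLieAlgebra ℝ →ₗ[ℝ] A.ToLieAlgebra ℝ) with hV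
  have mem_W : ∀ {z}, z ∈ W ↔ ∃ n, z ∈ borelFiltration A n := fun {z} =>
    Submodule.mem_iSup_of_directed _ (borelFiltration_mono A).directed_le
  have mem_V : ∀ {z}, z ∈ W → involution A z ∈ V := fun hz => ⟨_, hz, rfl⟩
  have he : ∀ i, e A i ∈ W := fun i => mem_W.2 ⟨1, e_mem_borelFiltration A 0 i⟩
  have hf : ∀ i, f A i ∈ V := fun i => by
    have := neg_mem (mem_V (he i))
    rwa [involution_e, neg_neg] at this
  have hh : ∀ i, h A i ∈ W := fun i => mem_W.2 ⟨0, h_mem_borelFiltration A 0 i⟩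
  have hfV : Submodule.span ℝ (Set.range (f A)) ≤ V :=
    Submodule.span_le.2 (by rintro _ ⟨i, rfl⟩; exact hf i)
  have hWe : ∀ i, ∀ z ∈ W, ⁅e A i, z⁆ ∈ W := fun i z hz => by
    obtain ⟨n, hn⟩ := mem_W.1 hz
    exact mem_W.2 ⟨n + 1, lie_e_mem_borelFiltration A i hn⟩
  have hWf : ∀ i, ∀ z ∈ W, ⁅f A i, z⁆ ∈ W ⊔ V := fun i z hz => by
    obtain ⟨n, hn⟩ := mem_W.1 hz
    exact sup_le_sup (le_iSup (borelFiltration A) _) hfV (lie_f_mem_borelFiltration A n i hn)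
  -- The involution exchanges `W` and `V`, so closure of the `V` part under `e`, `f`, `h` is read
  -- off from closure of the `W` part under `f`, `e`, `h`.
  have hinv : ∀ z ∈ W ⊔ V, involution A z ∈ W ⊔ V := fun z hz => by
    obtain ⟨a, ha, _, ⟨b, hb, rfl⟩, rfl⟩ := Submodule.mem_sup.1 hz
    rw [map_add]
    refine add_mem (Submodule.mem_sup_right (mem_V ha)) (Submodule.mem_sup_left ?_)
    change involution A (involution A b) ∈ W
    rwa [involution_involution]
  refine submodule_eq_top_of_generators A (fun i => Submodule.mem_sup_left (he i))
    (fun i => Submodule.mem_sup_right (hf i)) (fun i => Submodule.mem_sup_left (hh i)) ?_ ?_ ?_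
  · intro i z hz
    obtain ⟨a, ha, _, ⟨b, hb, rfl⟩, rfl⟩ := Submodule.mem_sup.1 hz
    rw [lie_add]
    refine add_mem (Submodule.mem_sup_left (hWe i a ha)) ?_
    have := neg_mem (hinv _ (hWf i b hb))
    rwa [LieHom.map_lie, involution_f, neg_lie, neg_neg] at this
  · intro i z hz
    obtain ⟨a, ha, _, ⟨b, hb, rfl⟩, rfl⟩ := Submodule.mem_sup.1 hz
    rw [lie_add]
    refine add_mem (hWf i a ha) ?_
    have := neg_mem (mem_V (hWe i b hb))
    rw [LieHom.map_lie, involution_e, neg_lie, neg_neg] at this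
    exact Submodule.mem_sup_right this
  · intro i z hz
    have hWh : ∀ i, ∀ z ∈ W, ⁅h A i, z⁆ ∈ W := fun i z hz => by
      obtain ⟨n, hn⟩ := mem_W.1 hz
      exact mem_W.2 ⟨n, lie_h_mem_borelFiltration A n i hn⟩
    obtain ⟨a, ha, _, ⟨b, hb, rfl⟩, rfl⟩ := Submodule.mem_sup.1 hz
    rw [lie_add]
    refine add_mem (Submodule.mem_sup_left (hWh i a ha)) ?_
    have := neg_mem (mem_V (hWh i b hb))
    rw [LieHom.map_lie, involution_h, neg_lie, neg_neg] at this
    exact Submodule.mem_sup_right this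

/-- Induction on height, with `x = e i - f i`: `⁅e i, z⁆ + ω⁅e i, z⁆ = ⁅x, z + ω z⁆ + (⁅f i, z⁆ +
ω⁅f i, z⁆)`, where the last bracket is already covered because `f i` lowers the height of `z` or
yields an element of the span of the `f`. -/
theorem add_involution_mem (y : A.ToLieAlgebra ℝ) :
    y + involution A y ∈ LieSubalgebra.lieSpan ℝ (A.ToLieAlgebra ℝ)
      (Set.range fun i => e A i - f A i) := by
  set S := LieSubalgebra.lieSpan ℝ (A.ToLieAlgebra ℝ) (Set.range fun i => e A i - f A i)
  let T : Submodule ℝ (A.ToLieAlgebra ℝ) := S.toSubmodule.comap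
    (LinearMap.id + (involution A : A.ToLieAlgebra ℝ →ₗ[ℝ] A.ToLieAlgebra ℝ))
  have mem_T : ∀ z, z ∈ T ↔ z + involution A z ∈ S := fun z => Iff.rfl
  have hx : ∀ i, e A i - f A i ∈ S := fun i => LieSubalgebra.subset_lieSpan ⟨i, rfl⟩
  have hf : Submodule.span ℝ (Set.range (f A)) ≤ T := Submodule.span_le.2 (by
    rintro _ ⟨i, rfl⟩
    rw [SetLike.mem_coe, mem_T, involution_f, ← sub_eq_add_neg, ← neg_sub]
    exact neg_mem (hx i))
  have hW : ∀ n, borelFiltration A n ≤ T := by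
    intro n
    induction n with
    | zero =>
      refine Submodule.span_le.2 ?_
      rintro _ ⟨i, rfl⟩
      rw [SetLike.mem_coe, mem_T, involution_h, add_neg_cancel]
      exact zero_mem S
    | succ n ih =>
      refine borelFiltration_succ_le A ih (fun i => ?_) fun i z hz => ?_
      · rw [mem_T, involution_e, ← sub_eq_add_neg]
        exact hx i
      · have h1 : ⁅f A i, z⁆ ∈ T :=
          (sup_le ((borelFiltration_mono A (Nat.sub_le n 1)).trans ih) hf)
            (lie_f_mem_borelFiltration A n i hz)
        have h2 := S.lie_mem (hx i) ((mem_T z).1 (ih hz))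
        rw [mem_T, LieHom.map_lie] at h1 ⊢
        rw [involution_f] at h1
        rw [involution_e]
        have h3 := add_mem h2 h1
        simp only [sub_lie, lie_add, neg_lie] at h3 ⊢
        convert h3 using 1
        abel
  have hT : (⨆ n, borelFiltration A n) ⊔ (⨆ n, borelFiltration A n).map
      (involution A : A.ToLieAlgebra ℝ →ₗ[ℝ] A.ToLieAlgebra ℝ) ≤ T := by
    refine sup_le (iSup_le hW) ?_
    rintro _ ⟨b, hb, rfl⟩
    have := (mem_T b).1 (iSup_le hW hb)
    change involution A b ∈ T
    rwa [mem_T, involution_involution, add_comm]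
  rw [iSup_borelFiltration_sup_map_involution] at hT
  exact (mem_T y).1 (hT Submodule.mem_top)

/-- The involutory subalgebra is generated by the elements `e i - f i`. -/
theorem lieSpan_compactGenerator :
    LieSubalgebra.lieSpan ℝ (involutorySubalgebra A) (Set.range (compactGenerator A)) = ⊤ := by
  set S := LieSubalgebra.lieSpan ℝ (involutorySubalgebra A) (Set.range (compactGenerator A))
  refine eq_top_iff.2 fun y _ => ?_
  have hy : involution A y = y := y.2
  have h1 : LieSubalgebra.lieSpan ℝ (A.ToLieAlgebra ℝ) (Set.range fun i => e A i - f A i) ≤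
      S.map (involutorySubalgebra A).incl := by
    refine LieSubalgebra.lieSpan_le.2 ?_
    rintro _ ⟨i, rfl⟩
    exact ⟨compactGenerator A i, LieSubalgebra.subset_lieSpan ⟨i, rfl⟩, rfl⟩
  obtain ⟨z, hz, hzy⟩ := h1 (add_involution_mem A y)
  have h2 : z = (2 : ℝ) • y := by
    apply Subtype.ext
    change (z : A.ToLieAlgebra ℝ) = _ at hzy
    rw [hzy, hy]
    exact (two_smul ℝ _).symm
  have h3 : y = (2⁻¹ : ℝ) • z := by rw [h2, smul_smul]; norm_num
  rw [h3]
  exact S.smul_mem _ hz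

end KacMoody

/-! ### Chevalley, Serre and Berman relations in the simply laced case. -/

namespace KacMoody

variable {B : Type}

/-- A simply laced generalised Cartan matrix. -/
structure IsSimplyLaced (A : Matrix B B ℤ) : Prop where
  diag : ∀ i, A i i = 2
  off_diag : ∀ i j, i ≠ j → A i j = 0 ∧ A j i = 0 ∨ A i j = -1 ∧ A j i = -1

variable [DecidableEq B]

/-- A family of elements of a Lie ring satisfying the Chevalley relations, without the Serre
relations. -/
structure IsChevalley {L : Type*} [LieRing L] (A : Matrix B B ℤ) (E F H : B → L) : Prop where
  hh : ∀ i j, ⁅H i, H j⁆ = 0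
  ef : ∀ i j, ⁅E i, F j⁆ = if i = j then H i else 0
  he : ∀ i j, ⁅H i, E j⁆ = A i j • E j
  hf : ∀ i j, ⁅H i, F j⁆ = -(A i j • F j)

/-- Berman's relations for a simply laced matrix. -/
structure IsBerman {L : Type*} [LieRing L] (A : Matrix B B ℤ) (X : B → L) : Prop where
  comm : ∀ i j, i ≠ j → A i j = 0 → ⁅X i, X j⁆ = 0
  triple : ∀ i j, A i j = -1 → ⁅X i, ⁅X i, X j⁆⁆ = -X j

namespace IsChevalley

variable {L : Type*} [LieRing L] {A : Matrix B B ℤ} {E F H : B → L} (hc : IsChevalley A E F H)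
include hc

theorem fe (i j : B) : ⁅F i, E j⁆ = -(if j = i then H j else 0) := by
  rw [← lie_skew, hc.ef]

theorem fh (i j : B) : ⁅F i, H j⁆ = A j i • F i := by
  rw [← lie_skew, hc.hf, neg_neg]

/-- The Serre elements in the `F` commute with every `E k` by the Chevalley relations alone.
Together with the weight laws `lie_h_serre_zero` and `lie_h_serre_one`, this makes such an operator
on `U(𝔟) ⊗ V` determined by its values on `1 ⊗ V`. -/
theorem lie_e_serre_zero (hA : IsSimplyLaced A) {i j : B} (hij : i ≠ j) (h0 : A i j = 0) (k : B) :
    ⁅E k, ⁅F i, F j⁆⁆ = 0 := by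
  have hji : A j i = 0 := by
    rcases hA.off_diag i j hij with h | h
    · exact h.2
    · lia
  rw [leibniz_lie, hc.ef, hc.ef]
  split_ifs with h1 h2 h2
  · exact absurd (h1.symm.trans h2) hij
  · subst h1; simp [hc.hf, h0]
  · subst h2; simp [hc.fh, hji]
  · simp

theorem lie_e_serre_one (hA : IsSimplyLaced A) {i j : B} (h1 : A i j = -1) (k : B) :
    ⁅E k, ⁅F i, ⁅F i, F j⁆⁆⁆ = 0 := by
  have hij : i ≠ j := by rintro rfl; have := hA.diag i; lia
  have hji : A j i = -1 := by
    rcases hA.off_diag i j hij with h | h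
    · lia
    · exact h.2
  by_cases hki : k = i
  · subst hki
    simp [leibniz_lie (E k), hc.ef, leibniz_lie (H k), hc.hf, hij, hA.diag, h1]
    abel
  · by_cases hkj : k = j
    · subst hkj
      simp [leibniz_lie (E k), hc.ef, hki, hc.fh, hji]
    · simp [leibniz_lie (E k), hc.ef, hki, hkj]

theorem lie_h_serre_zero (i j k : B) :
    ⁅H k, ⁅F i, F j⁆⁆ = (-A k i - A k j) • ⁅F i, F j⁆ := by
  rw [leibniz_lie, hc.hf, hc.hf, neg_lie, lie_neg, zsmul_lie, lie_zsmul, sub_zsmul, neg_zsmul]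

theorem lie_h_serre_one (i j k : B) :
    ⁅H k, ⁅F i, ⁅F i, F j⁆⁆⁆ = (-A k i - A k i - A k j) • ⁅F i, ⁅F i, F j⁆⁆ := by
  rw [leibniz_lie, hc.lie_h_serre_zero, hc.hf, neg_lie, zsmul_lie, lie_zsmul]
  simp only [sub_zsmul, neg_zsmul]
  abel

/-- Given the Serre relations of the `E`, the defect in a Berman relation for `E - F` is, up to
sign, the Serre element in the `F`. Thus Berman's relations on a subspace are equivalent to
vanishing of the Serre elements there; `berman_one` is the cubic case. -/
theorem berman_zero {i j : B} (hij : i ≠ j) (he : ⁅E i, E j⁆ = 0) :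
    ⁅E i - F i, E j - F j⁆ = ⁅F i, F j⁆ := by
  simp [he, hc.ef, hc.fe, hij, hij.symm]

theorem berman_one {i j : B} (hij : i ≠ j) (h1 : A i j = -1) (he : ⁅E i, ⁅E i, E j⁆⁆ = 0) :
    ⁅E i - F i, ⁅E i - F i, E j - F j⁆⁆ = -(E j - F j) - ⁅F i, ⁅F i, F j⁆⁆ := by
  have h2 : ⁅E i - F i, E j - F j⁆ = ⁅E i, E j⁆ + ⁅F i, F j⁆ := by
    rw [sub_lie, lie_sub, lie_sub, hc.ef, hc.fe, if_neg hij, if_neg hij.symm]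
    abel
  have h3 : ⁅E i, ⁅F i, F j⁆⁆ = F j := by
    simp [leibniz_lie (E i), hc.ef, hij, hc.hf, h1]
  have h4 : ⁅F i, ⁅E i, E j⁆⁆ = E j := by
    rw [leibniz_lie (F i), hc.fe, hc.fe, if_pos rfl, if_neg hij.symm, neg_lie, hc.he, h1]
    simp
  rw [h2, sub_lie, lie_add, lie_add, he, h3, h4]
  abel

end IsChevalley

/-- The representation of the Kac–Moody algebra determined by operators satisfying the
Chevalley–Serre relations. -/
theorem exists_lieHom {L : Type*} [LieRing L] [LieAlgebra ℝ L] {A : Matrix B B ℤ}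
    (hA : IsSimplyLaced A) {E F H : B → L} (hc : IsChevalley A E F H)
    (he0 : ∀ i j, i ≠ j → A i j = 0 → ⁅E i, E j⁆ = 0)
    (he1 : ∀ i j, A i j = -1 → ⁅E i, ⁅E i, E j⁆⁆ = 0)
    (hf0 : ∀ i j, i ≠ j → A i j = 0 → ⁅F i, F j⁆ = 0)
    (hf1 : ∀ i j, A i j = -1 → ⁅F i, ⁅F i, F j⁆⁆ = 0) :
    ∃ φ : A.ToLieAlgebra ℝ →ₗ⁅ℝ⁆ L, (∀ i, φ (e A i) = E i) ∧ ∀ i, φ (f A i) = F i := by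
  let g : CartanMatrix.Generators B → L := fun t => match t with
    | .H i => H i
    | .E i => E i
    | .F i => F i
  let Φ : FreeLieAlgebra ℝ (CartanMatrix.Generators B) →ₗ⁅ℝ⁆ L := FreeLieAlgebra.lift ℝ g
  have hΦ : ∀ t, Φ (FreeLieAlgebra.of ℝ t) = g t := fun t => FreeLieAlgebra.lift_of_apply g t
  have serre : ∀ (G : B → L), (∀ i j, i ≠ j → A i j = 0 → ⁅G i, G j⁆ = 0) →
      (∀ i j, A i j = -1 → ⁅G i, ⁅G i, G j⁆⁆ = 0) → ∀ i j,
      (LieAlgebra.ad ℝ L (G i) ^ (-A i j).toNat) ⁅G i, G j⁆ = 0 := by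
    intro G h0 h1 i j
    by_cases hij : i = j
    · subst hij; simp
    · rcases hA.off_diag i j hij with h | h
      · simp [h.1, h0 i j hij h.1]
      · simp [h.1, h1 i j h.1]
  have hker : CartanMatrix.Relations.toIdeal ℝ A ≤ Φ.ker := by
    refine LieSubmodule.lieSpan_le.2 ?_
    rintro x (((((⟨⟨i, j⟩, rfl⟩ | ⟨⟨i, j⟩, rfl⟩) | ⟨⟨i, j⟩, rfl⟩) | ⟨⟨i, j⟩, rfl⟩) | ⟨⟨i, j⟩, rfl⟩) |
      ⟨⟨i, j⟩, rfl⟩) <;> simp only [SetLike.mem_coe, LieHom.mem_ker]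
    · simp [CartanMatrix.Relations.HH, hΦ, g, hc.hh]
    · by_cases hij : i = j
      · subst hij
        simp [CartanMatrix.Relations.EF, hΦ, g, hc.ef]
      · simp [CartanMatrix.Relations.EF, hΦ, g, hc.ef, hij]
    · simp [CartanMatrix.Relations.HE, hΦ, g, hc.he]
    · simp [CartanMatrix.Relations.HF, hΦ, g, hc.hf]
    · simpa [CartanMatrix.Relations.adE, hΦ, g, map_ad_pow] using serre E he0 he1 i j
    · simpa [CartanMatrix.Relations.adF, hΦ, g, map_ad_pow] using serre F hf0 hf1 i j
  refine ⟨{ toLinearMap := (CartanMatrix.Relations.toIdeal ℝ A).toSubmodule.liftQ Φ.toLinearMap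
              fun _ hx => hker hx
            map_lie' := ?_ }, fun i => hΦ _, fun i => hΦ _⟩
  intro x y
  obtain ⟨x, rfl⟩ := Submodule.mkQ_surjective _ x
  obtain ⟨y, rfl⟩ := Submodule.mkQ_surjective _ y
  exact LieHom.map_lie Φ x y

end KacMoody

namespace KacMoody

variable {B : Type}

/-! ### The enveloping algebra of the Borel subalgebra -/

/-- The defining relations of the enveloping algebra of the Borel subalgebra. -/
inductive BorelRel (A : Matrix B B ℤ) : FreeAlgebra ℝ (B ⊕ B) → FreeAlgebra ℝ (B ⊕ B) → Prop
  | hh (i j : B) : BorelRel A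
      (FreeAlgebra.ι ℝ (Sum.inr i) * FreeAlgebra.ι ℝ (Sum.inr j))
      (FreeAlgebra.ι ℝ (Sum.inr j) * FreeAlgebra.ι ℝ (Sum.inr i))
  | he (i j : B) : BorelRel A
      (FreeAlgebra.ι ℝ (Sum.inr i) * FreeAlgebra.ι ℝ (Sum.inl j))
      (FreeAlgebra.ι ℝ (Sum.inl j) * FreeAlgebra.ι ℝ (Sum.inr i) +
        A i j • FreeAlgebra.ι ℝ (Sum.inl j))
  | ee (i j : B) (hij : i ≠ j) (h : A i j = 0) : BorelRel A
      (FreeAlgebra.ι ℝ (Sum.inl i) * FreeAlgebra.ι ℝ (Sum.inl j))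
      (FreeAlgebra.ι ℝ (Sum.inl j) * FreeAlgebra.ι ℝ (Sum.inl i))
  | eee (i j : B) (h : A i j = -1) : BorelRel A
      (FreeAlgebra.ι ℝ (Sum.inl i) * (FreeAlgebra.ι ℝ (Sum.inl i) * FreeAlgebra.ι ℝ (Sum.inl j)) +
        FreeAlgebra.ι ℝ (Sum.inl j) * (FreeAlgebra.ι ℝ (Sum.inl i) * FreeAlgebra.ι ℝ (Sum.inl i)))
      (FreeAlgebra.ι ℝ (Sum.inl i) * (FreeAlgebra.ι ℝ (Sum.inl j) * FreeAlgebra.ι ℝ (Sum.inl i)) +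
        FreeAlgebra.ι ℝ (Sum.inl i) * (FreeAlgebra.ι ℝ (Sum.inl j) * FreeAlgebra.ι ℝ (Sum.inl i)))

/-- The enveloping algebra of the Borel subalgebra. -/
def BorelAlgebra (A : Matrix B B ℤ) : Type := RingQuot (BorelRel A)

instance (A : Matrix B B ℤ) : Ring (BorelAlgebra A) :=
  inferInstanceAs (Ring (RingQuot (BorelRel A)))

instance (A : Matrix B B ℤ) : Algebra ℝ (BorelAlgebra A) :=
  inferInstanceAs (Algebra ℝ (RingQuot (BorelRel A)))

namespace BorelAlgebra

variable (A : Matrix B B ℤ)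

/-- The quotient map onto the Borel algebra. -/
def mk : FreeAlgebra ℝ (B ⊕ B) →ₐ[ℝ] BorelAlgebra A := RingQuot.mkAlgHom ℝ (BorelRel A)

theorem mk_rel {a b : FreeAlgebra ℝ (B ⊕ B)} (h : BorelRel A a b) : mk A a = mk A b :=
  RingQuot.mkAlgHom_rel ℝ h

/-- The generator `e i`. -/
def e (i : B) : BorelAlgebra A := mk A (FreeAlgebra.ι ℝ (Sum.inl i))

/-- The generator `h i`. -/
def h (i : B) : BorelAlgebra A := mk A (FreeAlgebra.ι ℝ (Sum.inr i))

theorem h_mul_h (i j : B) : h A i * h A j = h A j * h A i := by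
  simpa [h] using mk_rel A (BorelRel.hh i j)

theorem h_mul_e (i j : B) : h A i * e A j = e A j * h A i + A i j • e A j := by
  simpa [h, e] using mk_rel A (BorelRel.he i j)

theorem h_mul_e_mul (i j : B) (a : BorelAlgebra A) :
    h A i * (e A j * a) = e A j * (h A i * a) + A i j • (e A j * a) := by
  rw [← mul_assoc, h_mul_e, add_mul, mul_assoc, smul_mul_assoc]

theorem e_mul_e {i j : B} (hij : i ≠ j) (h : A i j = 0) : e A i * e A j = e A j * e A i := by
  simpa [e] using mk_rel A (BorelRel.ee i j hij h)

theorem e_serre {i j : B} (h : A i j = -1) :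
    e A i * (e A i * e A j) + e A j * (e A i * e A i) =
      e A i * (e A j * e A i) + e A i * (e A j * e A i) := by
  simpa [e] using mk_rel A (BorelRel.eee i j h)

theorem submodule_eq_top {N : Submodule ℝ (BorelAlgebra A)} (h1 : 1 ∈ N)
    (he : ∀ i, ∀ a ∈ N, e A i * a ∈ N) (hh : ∀ i, ∀ a ∈ N, h A i * a ∈ N) : N = ⊤ := by
  have key : ∀ y : FreeAlgebra ℝ (B ⊕ B), ∀ a ∈ N, mk A y * a ∈ N := by
    intro y
    induction y using FreeAlgebra.induction with
    | grade0 r =>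
      intro a ha
      rw [AlgHom.commutes, ← Algebra.smul_def]
      exact N.smul_mem r ha
    | grade1 t =>
      rcases t with i | i
      · exact he i
      · exact hh i
    | mul y z hy hz =>
      intro a ha
      rw [map_mul, mul_assoc]
      exact hy _ (hz a ha)
    | add y z hy hz =>
      intro a ha
      rw [map_add, add_mul]
      exact add_mem (hy a ha) (hz a ha)
  refine eq_top_iff.2 fun a _ => ?_
  obtain ⟨y, hy⟩ : ∃ y, mk A y = a := RingQuot.mkAlgHom_surjective ℝ (BorelRel A) a
  simpa [hy] using key y 1 h1

/-- The algebra homomorphism out of the Borel algebra determined by images of the generators. -/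
theorem exists_algHom {S : Type} [Ring S] [Algebra ℝ S] (E H : B → S)
    (hh : ∀ i j, H i * H j = H j * H i)
    (he : ∀ i j, H i * E j = E j * H i + A i j • E j)
    (ee : ∀ i j, i ≠ j → A i j = 0 → E i * E j = E j * E i)
    (eee : ∀ i j, A i j = -1 → E i * (E i * E j) + E j * (E i * E i) =
      E i * (E j * E i) + E i * (E j * E i)) :
    ∃ φ : BorelAlgebra A →ₐ[ℝ] S, (∀ i, φ (e A i) = E i) ∧ ∀ i, φ (h A i) = H i := by
  refine ⟨RingQuot.liftAlgHom ℝ ⟨FreeAlgebra.lift ℝ (Sum.elim E H), ?_⟩, fun i => ?_, fun i => ?_⟩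
  · rintro _ _ (⟨i, j⟩ | ⟨i, j⟩ | ⟨i, j, hij, h⟩ | ⟨i, j, h⟩)
    · simpa using hh i j
    · simpa using he i j
    · simpa using ee i j hij h
    · simpa using eee i j h
  · exact (RingQuot.liftAlgHom_mkAlgHom_apply ℝ _ _ _).trans (by simp)
  · exact (RingQuot.liftAlgHom_mkAlgHom_apply ℝ _ _ _).trans (by simp)

/-- The augmentation of the Borel algebra. -/
theorem nonempty_counit : Nonempty (BorelAlgebra A →ₐ[ℝ] ℝ) := by
  obtain ⟨ε, -⟩ := exists_algHom A (S := ℝ) (fun _ => 0) (fun _ => 0) (by simp) (by simp) (by simp)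
    (by simp)
  exact ⟨ε⟩

/-- The commutation rule for moving `f i` past elements of the Borel algebra. -/
theorem exists_twist [DecidableEq B] (hA : IsSimplyLaced A) (i : B) :
    ∃ φ : BorelAlgebra A →ₐ[ℝ] Matrix (Fin 2) (Fin 2) (BorelAlgebra A),
      (∀ j, φ (e A j) = !![e A j, -(if j = i then h A j else 0); 0, e A j]) ∧
      ∀ j, φ (h A j) = !![h A j + A j i • 1, 0; 0, h A j] := by
  -- The matrices encode `f i * a = τ a * f i + D a`, with `τ` in the upper left corner, `D` in the
  -- upper right and the identity in the lower right. Multiplicativity is the twisted Leibniz rule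
  -- `D (a b) = τ a * D b + D a * b`, so it is enough to check the Borel relations on generators.
  refine exists_algHom A _ _ ?_ ?_ ?_ ?_
  · intro j k
    simp [mul_add, add_mul, h_mul_h A j k, (Int.cast_commute (A j i) (h A k)).eq,
      (Int.cast_commute (A j i) (A k i : BorelAlgebra A)).eq,
      (Int.cast_commute (A k i) (h A j)).eq]
    abel
  · intro j k
    simp only [Matrix.mul_fin_two, mul_add, add_mul, h_mul_e A j k, Matrix.smul_of,
      Matrix.of_add_of]
    ext a b
    fin_cases a <;> fin_cases b <;> simp
    · rw [(Int.cast_commute (A j i) (e A k)).eq]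
      abel
    · split_ifs with hk
      · subst hk
        simp [h_mul_h A j k]
      · simp
  · intro j k hjk h
    have hkj : A k j = 0 := by rcases hA.off_diag j k hjk with h | h <;> lia
    rw [Matrix.mul_fin_two, Matrix.mul_fin_two, e_mul_e A hjk h]
    by_cases h1 : j = i
    · subst h1
      simp [h_mul_e, h, hjk.symm]
    · by_cases h2 : k = i
      · subst h2
        simp [h_mul_e, hkj, hjk]
      · simp [h1, h2]
  · intro j k h
    have hjk : j ≠ k := by rintro rfl; have := hA.diag j; lia
    have hkj : A k j = -1 := by rcases hA.off_diag j k hjk with h | h <;> lia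
    simp only [Matrix.mul_fin_two]
    have := e_serre A h
    by_cases h1 : j = i
    · subst h1
      ext a b
      fin_cases a <;> fin_cases b <;>
        simp [this, mul_add, h_mul_e, h_mul_e_mul, h, hjk.symm, hA.diag, two_mul]
      abel
    · by_cases h2 : k = i
      · subst h2
        ext a b
        fin_cases a <;> fin_cases b <;>
          simp [this, mul_add, h_mul_e, h_mul_e_mul, hkj, hjk]
        module
      · simp [h1, h2, this]

end BorelAlgebra

end KacMoody

/-! ### The induced module and the extension of representations from Berman's relations. -/

namespace KacMoody

open scoped TensorProduct

variable {B : Type} [DecidableEq B]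

/-- In the induced module, `f i * a = τ a * f i + D a` and `f i = e i - x i`. Hence `f i` acts by `a
⊗ v ↦ (τ a * e i + D a) ⊗ v - τ a ⊗ R i v`, and `P a = τ a * e i + D a` collects the part that does
not involve `R i`. -/
theorem BorelAlgebra.exists_operators (A : Matrix B B ℤ) (hA : IsSimplyLaced A) (i : B) :
    ∃ τ P : Module.End ℝ (BorelAlgebra A), τ 1 = 1 ∧ P 1 = e A i ∧
      (∀ j a, τ (e A j * a) = e A j * τ a) ∧
      (∀ j a, τ (h A j * a) = h A j * τ a + A j i • τ a) ∧
      (∀ j a, P (e A j * a) = e A j * P a - if j = i then h A j * a else 0) ∧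
      ∀ j a, P (h A j * a) = h A j * P a + A j i • P a := by
  obtain ⟨φ, hφe, hφh⟩ := exists_twist A hA i
  let ent (k l : Fin 2) : BorelAlgebra A →ₗ[ℝ] BorelAlgebra A :=
    (Matrix.entryLinearMap ℝ (BorelAlgebra A) k l) ∘ₗ φ.toLinearMap
  have hent : ∀ k l a, ent k l a = φ a k l := fun _ _ _ => rfl
  -- The lower row must be `(0, a)` for the upper right entry to obey the twisted Leibniz rule.
  have h0 : ∀ a, φ a 1 0 = 0 ∧ φ a 1 1 = a := by
    let N : Submodule ℝ (BorelAlgebra A) :=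
      LinearMap.ker (ent 1 0) ⊓ LinearMap.eqLocus (ent 1 1) LinearMap.id
    have mem_N : ∀ a, a ∈ N ↔ φ a 1 0 = 0 ∧ φ a 1 1 = a := fun a => Iff.rfl
    have : N = ⊤ := by
      refine submodule_eq_top A ?_ (fun j a ha => ?_) (fun j a ha => ?_)
      · simp [mem_N]
      · rw [mem_N] at ha ⊢
        simp [map_mul, hφe, Matrix.mul_apply, ha]
      · rw [mem_N] at ha ⊢
        simp [map_mul, hφh, Matrix.mul_apply, ha]
    intro a
    exact (mem_N a).1 (this ▸ Submodule.mem_top)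
  refine ⟨ent 0 0, LinearMap.mulRight ℝ (e A i) ∘ₗ ent 0 0 + ent 0 1, ?_, ?_, ?_, ?_, ?_, ?_⟩
  · simp [hent]
  · simp [hent]
  · intro j a
    simp [hent, hφe, Matrix.mul_apply, h0]
  · intro j a
    simp [hent, hφh, Matrix.mul_apply, h0, add_mul]
  · intro j a
    simp only [LinearMap.add_apply, LinearMap.comp_apply, hent, LinearMap.mulRight_apply, map_mul,
      hφe, Matrix.mul_apply, Fin.sum_univ_two, h0]
    split_ifs <;> simp [mul_add, mul_assoc]
    abel
  · intro j a
    simp [hent, hφh, Matrix.mul_apply, h0, mul_add, add_mul, mul_assoc]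
    abel

/-- Every representation of Berman's relations extends to the involutory subalgebra. -/
theorem exists_involutorySubalgebra_rep {A : Matrix B B ℤ} (hA : IsSimplyLaced A) {V : Type}
    [AddCommGroup V] [Module ℝ V] {R : B → Module.End ℝ V} (hR : IsBerman A R) :
    ∃ ρ : involutorySubalgebra A →ₗ⁅ℝ⁆ Module.End ℝ V, ∀ i, ρ (compactGenerator A i) = R i := by
  choose τ P hτ1 hP1 hτe hτh hPe hPh using BorelAlgebra.exists_operators A hA
  let M := BorelAlgebra A ⊗[ℝ] V
  let E : B → Module.End ℝ M := fun i =>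
    TensorProduct.map (LinearMap.mulLeft ℝ (BorelAlgebra.e A i)) LinearMap.id
  let H : B → Module.End ℝ M := fun i =>
    TensorProduct.map (LinearMap.mulLeft ℝ (BorelAlgebra.h A i)) LinearMap.id
  let F : B → Module.End ℝ M := fun i =>
    TensorProduct.map (P i) LinearMap.id - TensorProduct.map (τ i) (R i)
  have hE : ∀ i a v, E i (a ⊗ₜ[ℝ] v) = (BorelAlgebra.e A i * a) ⊗ₜ[ℝ] v := fun _ _ _ => rfl
  have hH : ∀ i a v, H i (a ⊗ₜ[ℝ] v) = (BorelAlgebra.h A i * a) ⊗ₜ[ℝ] v := fun _ _ _ => rfl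
  have hF : ∀ i a v, F i (a ⊗ₜ[ℝ] v) = P i a ⊗ₜ[ℝ] v - τ i a ⊗ₜ[ℝ] R i v := fun _ _ _ => rfl
  have hz : ∀ (n : ℤ) (b : BorelAlgebra A) (v : V), (n • b) ⊗ₜ[ℝ] v = n • b ⊗ₜ[ℝ] v :=
    fun n b v => map_zsmul ((TensorProduct.mk ℝ (BorelAlgebra A) V).flip v) n b
  have hc : IsChevalley A E F H := by
    refine ⟨fun i j => ?_, fun i j => ?_, fun i j => ?_, fun i j => ?_⟩
    · refine TensorProduct.ext' fun a v => ?_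
      rw [LieRing.of_associative_ring_bracket]
      simp [hH, ← mul_assoc, BorelAlgebra.h_mul_h A i j]
    · refine TensorProduct.ext' fun a v => ?_
      rw [LieRing.of_associative_ring_bracket]
      split_ifs with hij <;>
        simp [hH, hE, hF, hPe, hτe, hij, TensorProduct.sub_tmul]
    · refine TensorProduct.ext' fun a v => ?_
      rw [LieRing.of_associative_ring_bracket]
      simp [hH, hE, BorelAlgebra.h_mul_e_mul, TensorProduct.add_tmul, TensorProduct.smul_tmul']
    · refine TensorProduct.ext' fun a v => ?_
      rw [LieRing.of_associative_ring_bracket]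
      simp [hH, hF, hPh, hτh, TensorProduct.add_tmul, hz, smul_sub, -zsmul_eq_mul]
      abel
  have he0 : ∀ i j, i ≠ j → A i j = 0 → ⁅E i, E j⁆ = 0 := by
    intro i j hij h
    refine TensorProduct.ext' fun a v => ?_
    rw [LieRing.of_associative_ring_bracket]
    simp [hE, ← mul_assoc, BorelAlgebra.e_mul_e A hij h]
  have he1 : ∀ i j, A i j = -1 → ⁅E i, ⁅E i, E j⁆⁆ = 0 := by
    intro i j h
    refine TensorProduct.ext' fun a v => ?_
    have := congrArg (fun b => (b * a) ⊗ₜ[ℝ] v) (BorelAlgebra.e_serre A h)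
    simp only [LieRing.of_associative_ring_bracket]
    simp only [add_mul, mul_assoc, TensorProduct.add_tmul] at this
    simp only [LinearMap.sub_apply, Module.End.mul_apply, map_sub, hE, LinearMap.zero_apply]
    rw [← sub_eq_zero.2 this]
    abel
  let ι : V →ₗ[ℝ] M := TensorProduct.mk ℝ (BorelAlgebra A) V 1
  have hXι : ∀ i v, (E i - F i) (ι v) = ι (R i v) := by
    intro i v
    change E i (1 ⊗ₜ[ℝ] v) - F i (1 ⊗ₜ[ℝ] v) = 1 ⊗ₜ[ℝ] R i v
    rw [hE, hF, hτ1, hP1, mul_one]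
    abel
  -- Left multiplications by the `e k` and `h k` build the whole Borel algebra from `1`, and the
  -- kernel of such an `S` is stable under them; so `S` is zero once it kills `1 ⊗ V`.
  have vanish : ∀ (S : Module.End ℝ M) (c : B → ℤ), (∀ k, ⁅E k, S⁆ = 0) →
      (∀ k, ⁅H k, S⁆ = c k • S) → (∀ v, S (ι v) = 0) → S = 0 := by
    intro S c hSe hSh hS1
    refine TensorProduct.ext' fun a v => ?_
    rw [LinearMap.zero_apply]
    have hSe' : ∀ k m, S (E k m) = E k (S m) := fun k m => by
      have := LinearMap.congr_fun (hSe k) m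
      rw [LieRing.of_associative_ring_bracket, LinearMap.sub_apply, LinearMap.zero_apply,
        sub_eq_zero] at this
      exact this.symm
    have hSh' : ∀ k m, S (H k m) = H k (S m) - c k • S m := fun k m => by
      have := LinearMap.congr_fun (hSh k) m
      rw [LieRing.of_associative_ring_bracket, LinearMap.sub_apply] at this
      rw [eq_sub_iff_add_eq, ← LinearMap.smul_apply, ← this]
      exact add_sub_cancel _ _
    let N : Submodule ℝ (BorelAlgebra A) :=
      LinearMap.ker (S ∘ₗ (TensorProduct.mk ℝ (BorelAlgebra A) V).flip v)
    have mem_N : ∀ a, a ∈ N ↔ S (a ⊗ₜ[ℝ] v) = 0 := fun a => Iff.rfl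
    have : N = ⊤ := by
      refine BorelAlgebra.submodule_eq_top A (hS1 v) (fun j a ha => ?_) (fun j a ha => ?_)
      · rw [mem_N] at ha ⊢
        rw [← hE, hSe', ha, map_zero]
      · rw [mem_N] at ha ⊢
        rw [← hH, hSh', ha, map_zero, smul_zero, sub_zero]
    exact (mem_N a).1 (this ▸ Submodule.mem_top)
  have hlie : ∀ (Y Z : Module.End ℝ M) (y z : Module.End ℝ V), (∀ v, Y (ι v) = ι (y v)) →
      (∀ v, Z (ι v) = ι (z v)) → ∀ v, ⁅Y, Z⁆ (ι v) = ι (⁅y, z⁆ v) := by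
    intro Y Z y z hY hZ v
    simp only [LieRing.of_associative_ring_bracket, LinearMap.sub_apply, Module.End.mul_apply, hY,
      hZ, map_sub]
  have ne_of : ∀ i j, A i j = -1 → i ≠ j := by
    rintro i j h rfl
    have := hA.diag i
    lia
  obtain ⟨φ, hφe, hφf⟩ := exists_lieHom hA hc he0 he1
    (fun i j hij h => vanish _ _ (hc.lie_e_serre_zero hA hij h) (hc.lie_h_serre_zero i j)
      fun v => by
        rw [← hc.berman_zero hij (he0 i j hij h), hlie _ _ _ _ (hXι i) (hXι j),
          hR.comm i j hij h, LinearMap.zero_apply, map_zero])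
    (fun i j h => vanish _ _ (hc.lie_e_serre_one hA h) (hc.lie_h_serre_one i j)
      fun v => by
        have h1 := hc.berman_one (ne_of i j h) h (he1 i j h)
        have h2 := hlie _ _ _ _ (hXι i) (hlie _ _ _ _ (hXι i) (hXι j)) v
        rw [h1, hR.triple i j h, LinearMap.sub_apply, LinearMap.neg_apply, hXι,
          LinearMap.neg_apply, map_neg] at h2
        simpa using h2)
  obtain ⟨ε⟩ := BorelAlgebra.nonempty_counit A
  -- The counit provides a left inverse of `ι`, used to read off the operator induced on `1 ⊗ V`.
  let π : M →ₗ[ℝ] V := TensorProduct.lift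
    ((LinearMap.toSpanSingleton ℝ (Module.End ℝ V) LinearMap.id) ∘ₗ ε.toLinearMap)
  have hπ : ∀ v, π (ι v) = v := fun v => by
    change TensorProduct.lift _ ((1 : BorelAlgebra A) ⊗ₜ[ℝ] v) = v
    rw [TensorProduct.lift.tmul]
    simp
  let Ψ : involutorySubalgebra A →ₗ⁅ℝ⁆ Module.End ℝ M := φ.comp (involutorySubalgebra A).incl
  have hΨx : ∀ i, Ψ (compactGenerator A i) = E i - F i := fun i => by
    rw [← hφe, ← hφf, ← map_sub]
    rfl
  -- The elements preserving `1 ⊗ V` form a subalgebra; it contains the generators, hence all of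
  -- `K`.
  let S : LieSubalgebra ℝ (involutorySubalgebra A) :=
    { carrier := {y | ∃ r : Module.End ℝ V, ∀ v, Ψ y (ι v) = ι (r v)}
      add_mem' := by
        rintro y z ⟨r, hr⟩ ⟨s, hs⟩
        exact ⟨r + s, fun v => by simp [hr, hs]⟩
      zero_mem' := ⟨0, by simp⟩
      smul_mem' := by
        rintro c y ⟨r, hr⟩
        exact ⟨c • r, fun v => by simp [hr]⟩
      lie_mem' := by
        rintro y z ⟨r, hr⟩ ⟨s, hs⟩
        exact ⟨⁅r, s⁆, fun v => by rw [LieHom.map_lie, hlie _ _ _ _ hr hs]⟩ }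
  have hS : S = ⊤ := by
    rw [eq_top_iff, ← lieSpan_compactGenerator, LieSubalgebra.lieSpan_le]
    rintro _ ⟨i, rfl⟩
    exact ⟨R i, fun v => by rw [hΨx, hXι]⟩
  have hΨ : ∀ y v, Ψ y (ι v) = ι (π (Ψ y (ι v))) := by
    intro y v
    obtain ⟨r, hr⟩ : y ∈ S := hS ▸ LieSubalgebra.mem_top y
    rw [hr, hπ]
  refine ⟨{ toFun := fun y => π ∘ₗ Ψ y ∘ₗ ι
            map_add' := fun y z => by ext v; simp
            map_smul' := fun c y => by ext v; simp
            map_lie' := ?_ }, fun i => ?_⟩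
  · intro y z
    ext v
    simp only [LieHom.map_lie, LieRing.of_associative_ring_bracket, LinearMap.comp_apply,
      LinearMap.sub_apply, Module.End.mul_apply, map_sub]
    rw [← hΨ z v, ← hΨ y v]
  · ext v
    change π (Ψ (compactGenerator A i) (ι v)) = R i v
    rw [hΨx, hXι, hπ]

end KacMoody

namespace E10

/-! ### Words in the gamma matrices -/

/-- The product of the gamma matrices along a list of indices. -/
def word (Γ : Fin 10 → Matrix (Fin 32) (Fin 32) ℝ) (l : List (Fin 10)) :
    Matrix (Fin 32) (Fin 32) ℝ := (l.map Γ).prod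

/-- The sign picked up when the words along `l` and `m` are interchanged. -/
def swapSign (l m : List (Fin 10)) : ℤ :=
  (l.map fun a => (m.map fun b => if a = b then (1 : ℤ) else -1).prod).prod

theorem swapSign_of_disjoint {l m : List (Fin 10)} (h : l.Disjoint m) :
    swapSign l m = (-1) ^ (l.length * m.length) := by
  have h1 : ∀ a ∈ l, (m.map fun b => if a = b then (1 : ℤ) else -1).prod = (-1) ^ m.length := by
    intro a ha
    rw [List.map_congr_left (g := fun _ => (-1 : ℤ)) fun b hb =>
      if_neg (by rintro rfl; exact h ha hb)]
    simp
  rw [swapSign, List.map_congr_left h1]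
  simp [← pow_mul, mul_comm]

section Words

variable {Γ : Fin 10 → Matrix (Fin 32) (Fin 32) ℝ}

@[simp] theorem word_nil : word Γ [] = 1 := rfl

@[simp] theorem word_cons (a : Fin 10) (l : List (Fin 10)) : word Γ (a :: l) = Γ a * word Γ l := by
  simp [word]

theorem word_append (l m : List (Fin 10)) : word Γ (l ++ m) = word Γ l * word Γ m := by
  simp [word]

variable (hΓ : IsGammaSystem Γ)
include hΓ

theorem IsGammaSystem.mul_self (a : Fin 10) : Γ a * Γ a = 1 := by
  have h := hΓ.anticomm a a
  rw [if_pos rfl, ← two_smul ℝ] at h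
  have h2 : (2 : Matrix (Fin 32) (Fin 32) ℝ) = (2 : ℝ) • 1 := by
    rw [two_smul, one_add_one_eq_two]
  rw [h2] at h
  exact smul_right_injective _ (two_ne_zero (α := ℝ)) h

theorem IsGammaSystem.mul_swap (a b : Fin 10) :
    Γ a * Γ b = (if a = b then (1 : ℤ) else -1) • (Γ b * Γ a) := by
  split_ifs with h
  · rw [h, one_smul]
  · have := hΓ.anticomm a b
    rw [if_neg h] at this
    rw [neg_one_smul]
    exact eq_neg_of_add_eq_zero_left this

theorem word_mul_word (l m : List (Fin 10)) :
    word Γ l * word Γ m = swapSign l m • (word Γ m * word Γ l) := by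
  have h1 : ∀ (a : Fin 10) (m : List (Fin 10)),
      Γ a * word Γ m = (m.map fun b => if a = b then (1 : ℤ) else -1).prod • (word Γ m * Γ a) := by
    intro a m
    induction m with
    | nil => simp
    | cons b m ih =>
      rw [word_cons, ← mul_assoc, hΓ.mul_swap a b, smul_mul_assoc, mul_assoc, ih, mul_smul_comm,
        smul_smul, List.map_cons, List.prod_cons, mul_assoc]
  induction l with
  | nil => simp [swapSign]
  | cons a l ih =>
    rw [word_cons, mul_assoc, ih, mul_smul_comm, ← mul_assoc, h1, smul_mul_assoc, smul_smul,
      mul_assoc, mul_comm]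
    rfl

theorem word_mul_word_of_disjoint {l m : List (Fin 10)} (h : l.Disjoint m) :
    word Γ l * word Γ m = (-1 : ℤ) ^ (l.length * m.length) • (word Γ m * word Γ l) := by
  rw [word_mul_word hΓ, swapSign_of_disjoint h]

theorem transpose_word (l : List (Fin 10)) : (word Γ l)ᵀ = word Γ l.reverse := by
  induction l with
  | nil => simp
  | cons a l ih =>
    rw [word_cons, Matrix.transpose_mul, ih, hΓ.symm, List.reverse_cons, word_append]
    simp

theorem word_reverse_mul_word (l : List (Fin 10)) : word Γ l.reverse * word Γ l = 1 := by
  induction l with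
  | nil => simp
  | cons a l ih =>
    rw [List.reverse_cons, word_append, word_cons, word_cons, word_nil, mul_one, mul_assoc,
      ← mul_assoc (Γ a), hΓ.mul_self, one_mul, ih]

/-- Each letter anticommutes past all later ones, and these exponents add up to `n.choose 2`. Since
reversal is transposition, words of length `2` or `3` modulo `4` are antisymmetric; they square to
`-1`. -/
theorem word_reverse {l : List (Fin 10)} (h : l.Nodup) :
    word Γ l.reverse = (-1 : ℤ) ^ (l.length.choose 2) • word Γ l := by
  induction l with
  | nil => simp
  | cons a l ih =>
    rw [List.nodup_cons] at h
    have h1 : word Γ l * word Γ [a] = (-1 : ℤ) ^ (l.length * 1) • (word Γ [a] * word Γ l) :=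
      word_mul_word_of_disjoint hΓ (by simpa using h.1)
    rw [List.reverse_cons, word_append, ih h.2, smul_mul_assoc, h1, smul_smul, word_cons, word_nil,
      mul_one, word_cons, List.length_cons, Nat.choose_succ_succ, Nat.choose_one_right, mul_one,
      ← pow_add, add_comm]

theorem word_mul_self {l : List (Fin 10)} (h : l.Nodup) :
    word Γ l * word Γ l = (-1 : ℤ) ^ (l.length.choose 2) • (1 : Matrix (Fin 32) (Fin 32) ℝ) := by
  have h1 := word_reverse_mul_word hΓ l
  rw [word_reverse hΓ h, smul_mul_assoc] at h1
  rw [← h1, smul_smul, ← mul_pow]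
  simp

end Words

/-! ### Polarisations -/

/-- The inner product of covectors given by the DeWitt metric. -/
def ip (u v : Fin 10 → ℝ) : ℝ := u ⬝ᵥ metric *ᵥ v

theorem metric_transpose : metricᵀ = metric := by
  ext a b
  simp [metric, eq_comm]

theorem ip_comm (u v : Fin 10 → ℝ) : ip u v = ip v u := by
  rw [ip, ip, Matrix.dotProduct_mulVec, ← Matrix.mulVec_transpose, metric_transpose,
    dotProduct_comm]

theorem ip_eq (u v : Fin 10 → ℝ) : ip u v = ∑ i, u i * v i - (1 / 9) * ((∑ i, u i) * ∑ i, v i) := by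
  have h : metric *ᵥ v = fun a => v a - 1 / 9 * ∑ i, v i := by
    ext a
    simp [metric, Matrix.mulVec, dotProduct, sub_mul, Finset.sum_sub_distrib, Finset.mul_sum]
  rw [ip, h]
  simp only [dotProduct, mul_sub, Finset.sum_sub_distrib, Finset.sum_mul, Finset.mul_sum]
  congr 1
  rw [Finset.sum_comm]
  exact Finset.sum_congr rfl fun i _ => Finset.sum_congr rfl fun j _ => by ring

theorem ip_add_left (u v w : Fin 10 → ℝ) : ip (u + v) w = ip u w + ip v w := add_dotProduct _ _ _

theorem ip_add_right (u v w : Fin 10 → ℝ) : ip u (v + w) = ip u v + ip u w := by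
  rw [ip_comm, ip_add_left, ip_comm v, ip_comm w]

theorem ip_smul_left (c : ℝ) (u v : Fin 10 → ℝ) : ip (c • u) v = c * ip u v := smul_dotProduct _ _ _

theorem ip_smul_right (c : ℝ) (u v : Fin 10 → ℝ) : ip u (c • v) = c * ip u v := by
  rw [ip_comm, ip_smul_left, ip_comm v]

theorem ip_neg_left (u v : Fin 10 → ℝ) : ip (-u) v = -ip u v := neg_dotProduct _ _

theorem ip_neg_right (u v : Fin 10 → ℝ) : ip u (-v) = -ip u v := by
  rw [ip_comm, ip_neg_left, ip_comm v]

/-- The matrix `u^a v_b`. -/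
def outer (u v : Fin 10 → ℝ) : Matrix (Fin 10) (Fin 10) ℝ := Matrix.vecMulVec (metric *ᵥ u) v

theorem outer_mul_outer (u v w z : Fin 10 → ℝ) :
    outer u v * outer w z = ip v w • outer u z := by
  rw [outer, outer, Matrix.vecMulVec_mul_vecMulVec, ip, outer, Matrix.vecMulVec_smul]

theorem outer_add_left (u v w : Fin 10 → ℝ) : outer (u + v) w = outer u w + outer v w := by
  rw [outer, Matrix.mulVec_add, Matrix.add_vecMulVec]; rfl

theorem outer_add_right (u v w : Fin 10 → ℝ) : outer u (v + w) = outer u v + outer u w :=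
  Matrix.vecMulVec_add _ _ _

theorem outer_smul_left (c : ℝ) (u v : Fin 10 → ℝ) : outer (c • u) v = c • outer u v := by
  rw [outer, Matrix.mulVec_smul, Matrix.smul_vecMulVec]; rfl

theorem outer_smul_right (c : ℝ) (u v : Fin 10 → ℝ) : outer u (c • v) = c • outer u v :=
  Matrix.vecMulVec_smul _ _ _

/-- The polarisation tensor of a real covector. -/
def pol (u : Fin 10 → ℝ) : Matrix (Fin 10) (Fin 10) ℝ :=
  (1 / 4 : ℝ) • 1 - (1 / 2 : ℝ) • outer u u

theorem pol_neg (u : Fin 10 → ℝ) : pol (-u) = pol u := by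
  rw [← neg_one_smul ℝ u, pol, outer_smul_left, outer_smul_right, smul_smul (-1 : ℝ)]
  simp [pol]

theorem polarisation_eq (α : Fin 10 → ℤ) : polarisation α = pol fun a => (α a : ℝ) := by
  ext a b
  simp [polarisation, pol, outer, Matrix.vecMulVec_apply, Matrix.mulVec, dotProduct,
    Matrix.one_apply]
  ring

theorem pol_mul_pol (u v : Fin 10 → ℝ) : pol u * pol v =
    (1 / 16 : ℝ) • 1 - (1 / 8 : ℝ) • outer u u - (1 / 8 : ℝ) • outer v v +
      (1 / 4 * ip u v) • outer u v := by
  simp only [pol, sub_mul, mul_sub, smul_mul_assoc, mul_smul_comm, one_mul, mul_one,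
    outer_mul_outer]
  module

/-- The cross terms enter with coefficient `ip u v / 4 = -1/4`, the same as that of `outer u u` and
`outer v v`, so they complete the square `outer (u + v) (u + v)`. This is why the constants `1/4`
and `1/2` in the polarisation fit together. -/
theorem pol_anticomm {u v : Fin 10 → ℝ} (h : ip u v = -1) :
    pol u * pol v + pol v * pol u = (1 / 2 : ℝ) • pol (u + v) := by
  rw [pol_mul_pol, pol_mul_pol, ip_comm v u, h, pol, outer_add_left, outer_add_right,
    outer_add_right]
  module

theorem pol_comm {u v : Fin 10 → ℝ} (h : ip u v = 0) : pol u * pol v = pol v * pol u := by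
  rw [pol_mul_pol, pol_mul_pol, ip_comm v u, h]
  module

theorem lie_kronecker_of_comm {X Y : Matrix (Fin 10) (Fin 10) ℝ}
    {g g' : Matrix (Fin 32) (Fin 32) ℝ} (h : g * g' = g' * g) :
    ⁅X ⊗ₖ g, Y ⊗ₖ g'⁆ = (X * Y - Y * X) ⊗ₖ (g * g') := by
  rw [LieRing.of_associative_ring_bracket, ← Matrix.mul_kronecker_mul, ← Matrix.mul_kronecker_mul,
    ← h]
  ext ⟨a, s⟩ ⟨b, t⟩
  simp [sub_mul]

theorem lie_kronecker_of_anticomm {X Y : Matrix (Fin 10) (Fin 10) ℝ}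
    {g g' : Matrix (Fin 32) (Fin 32) ℝ} (h : g * g' = -(g' * g)) :
    ⁅X ⊗ₖ g, Y ⊗ₖ g'⁆ = (X * Y + Y * X) ⊗ₖ (g * g') := by
  have h' : g' * g = (-1 : ℝ) • (g * g') := by rw [h]; simp
  rw [LieRing.of_associative_ring_bracket, ← Matrix.mul_kronecker_mul, ← Matrix.mul_kronecker_mul,
    h', Matrix.kronecker_smul, Matrix.add_kronecker]
  simp

theorem lie_pol_kronecker {u v : Fin 10 → ℝ} (huv : ip u v = -1)
    {g g' : Matrix (Fin 32) (Fin 32) ℝ} (h : g * g' = -(g' * g)) :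
    ⁅pol u ⊗ₖ g, pol v ⊗ₖ g'⁆ = (1 / 2 : ℝ) • (pol (u + v) ⊗ₖ (g * g')) := by
  rw [lie_kronecker_of_anticomm h, pol_anticomm huv, Matrix.smul_kronecker]

/-! ### Berman's relations -/

/-- The indices of the gamma matrices entering `Γ(α_i)`. -/
def simpleWord : Fin 10 → List (Fin 10) :=
  ![[0, 1], [1, 2], [2, 3], [3, 4], [4, 5], [5, 6], [6, 7], [7, 8], [8, 9], [7, 8, 9]]

/-- The simple roots as real covectors. -/
def root (i : Fin 10) : Fin 10 → ℝ := fun a => (simpleRoot i a : ℝ)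

theorem ip_root (i j : Fin 10) : ip (root i) (root j) = cartanMatrix i j := by
  have h : ∀ i j, 9 * ∑ a, simpleRoot i a * simpleRoot j a -
      (∑ a, simpleRoot i a) * ∑ a, simpleRoot j a = 9 * cartanMatrix i j := by decide +kernel
  have h1 : (9 : ℝ) * ∑ a, (simpleRoot i a : ℝ) * simpleRoot j a -
      (∑ a, (simpleRoot i a : ℝ)) * ∑ a, (simpleRoot j a : ℝ) = 9 * cartanMatrix i j := by
    exact_mod_cast h i j
  rw [ip_eq]
  simp only [root]
  linarith

/-- The entries of the Cartan matrix, as a function to which instance search applies. -/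
def cartanEntry (i j : Fin 10) : ℤ := cartanMatrix i j

theorem isSimplyLaced_cartanMatrix : KacMoody.IsSimplyLaced cartanMatrix := by
  have h : ∀ i j, i ≠ j → cartanEntry i j = 0 ∧ cartanEntry j i = 0 ∨
      cartanEntry i j = -1 ∧ cartanEntry j i = -1 := by decide +kernel
  exact ⟨by decide +kernel, h⟩

section Representation

variable {Γ : Fin 10 → Matrix (Fin 32) (Fin 32) ℝ} (hΓ : IsGammaSystem Γ)
include hΓ

theorem gammaOf_simpleRoot (i : Fin 10) : gammaOf Γ (simpleRoot i) = word Γ (simpleWord i) := by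
  -- Simple roots have entries `-1`, where the integer power is a matrix inverse.
  have hinv : ∀ a, (Γ a)⁻¹ = Γ a := fun a => Matrix.inv_eq_left_inv (hΓ.mul_self a)
  fin_cases i <;> simp [gammaOf, simpleRoot, simpleWord, word, List.ofFn_succ, Fin.succ, hinv]

theorem spinGenerator_simpleRoot (i : Fin 10) :
    spinGenerator Γ (simpleRoot i) = (-2 : ℝ) • (pol (root i) ⊗ₖ word Γ (simpleWord i)) := by
  rw [spinGenerator, gammaOf_simpleRoot hΓ, polarisation_eq]
  rfl

/-- For Cartan entry `0` both tensor factors commute. For `-1` the words anticommute, so the bracket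
is a multiple of the vector attached to the sum of the roots, and a second bracket returns to the
original root. -/
theorem isBerman_spinGenerator :
    KacMoody.IsBerman cartanMatrix fun i => spinGenerator Γ (simpleRoot i) := by
  refine ⟨fun i j hij h => ?_, fun i j h => ?_⟩
  · have h1 : ∀ i j, i ≠ j → cartanEntry i j = 0 →
        swapSign (simpleWord i) (simpleWord j) = 1 := by decide +kernel
    have h2 := word_mul_word hΓ (simpleWord i) (simpleWord j)
    rw [h1 i j hij h, one_smul] at h2
    have h3 : ip (root i) (root j) = 0 := by rw [ip_root, h, Int.cast_zero]
    simp only [spinGenerator_simpleRoot hΓ, lie_smul, smul_lie, lie_kronecker_of_comm h2,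
      pol_comm h3]
    simp
  · have h1 : ∀ i j, cartanEntry i j = -1 →
        swapSign (simpleWord i) (simpleWord j) = -1 := by decide +kernel
    have h2 := word_mul_word hΓ (simpleWord i) (simpleWord j)
    rw [h1 i j h, neg_one_smul] at h2
    have h3 : ip (root i) (root j) = -1 := by rw [ip_root, h, Int.cast_neg, Int.cast_one]
    have h4 : ip (root i) (root i) = 2 := by
      rw [ip_root, isSimplyLaced_cartanMatrix.diag]
      norm_num
    have h5 : word Γ (simpleWord i) * word Γ (simpleWord i) = -1 := by
      have : ∀ i, (simpleWord i).Nodup ∧ (-1 : ℤ) ^ ((simpleWord i).length.choose 2) = -1 := by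
        decide +kernel
      rw [word_mul_self hΓ (this i).1, (this i).2, neg_one_smul]
    have h6 : word Γ (simpleWord i) * (word Γ (simpleWord i) * word Γ (simpleWord j)) =
        -(word Γ (simpleWord i) * word Γ (simpleWord j) * word Γ (simpleWord i)) := by
      rw [mul_assoc (word Γ (simpleWord i)) (word Γ (simpleWord j)), ← mul_neg, ← h2]
    -- As `pol` is even, `root i` may be replaced by its negative; the pair then has inner product
    -- `-1` and sum `root j`. The sign in Berman's relation comes from `Γ(α_i)² = -1`.
    have h7 : ip (-root i) (root i + root j) = -1 := by
      rw [ip_neg_left, ip_add_right, h3, h4]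
      norm_num
    have h8 := lie_pol_kronecker h7 h6
    rw [pol_neg, neg_add_cancel_left, ← mul_assoc, h5, neg_one_mul] at h8
    simp only [spinGenerator_simpleRoot hΓ, lie_smul, smul_lie, lie_pol_kronecker h3 h2, h8]
    rw [← neg_one_smul ℝ (word Γ (simpleWord j)), Matrix.kronecker_smul]
    module

theorem exists_isSpinThreeHalves :
    ∃ ρ : K →ₗ⁅ℝ⁆ Matrix (Fin 10 × Fin 32) (Fin 10 × Fin 32) ℝ, IsSpinThreeHalves Γ ρ := by
  have hB := isBerman_spinGenerator hΓ
  let L : Matrix (Fin 10 × Fin 32) (Fin 10 × Fin 32) ℝ ≃ₗ⁅ℝ⁆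
    Module.End ℝ (Fin 10 × Fin 32 → ℝ) := lieEquivMatrix'.symm
  have hR : KacMoody.IsBerman cartanMatrix fun i => L (spinGenerator Γ (simpleRoot i)) := by
    refine ⟨fun i j hij h => ?_, fun i j h => ?_⟩
    · rw [← LieEquiv.map_lie, hB.comm i j hij h, map_zero]
    · rw [← LieEquiv.map_lie, ← LieEquiv.map_lie, hB.triple i j h, map_neg]
  obtain ⟨ρ, hρ⟩ := KacMoody.exists_involutorySubalgebra_rep isSimplyLaced_cartanMatrix hR
  refine ⟨L.symm.toLieHom.comp ρ, fun i => ?_⟩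
  change L.symm (ρ (x i)) = _
  rw [hρ, LieEquiv.symm_apply_apply]

end Representation

theorem lieHom_ext {L : Type*} [LieRing L] [LieAlgebra ℝ L] {ρ ρ' : K →ₗ⁅ℝ⁆ L}
    (h : ∀ i, ρ (x i) = ρ' (x i)) : ρ = ρ' := by
  refine LieHom.ext fun y => ?_
  have h1 : y ∈ LieSubalgebra.lieSpan ℝ K (Set.range x) :=
    (KacMoody.lieSpan_compactGenerator cartanMatrix).symm ▸ LieSubalgebra.mem_top y
  induction h1 using LieSubalgebra.lieSpan_induction with
  | mem y hy => obtain ⟨i, rfl⟩ := hy; exact h i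
  | zero => simp
  | add y z _ _ hy hz => simp [hy, hz]
  | smul c y _ hy => simp [hy]
  | lie y z _ _ hy hz => simp [hy, hz]

theorem range_le {L : Type*} [LieRing L] [LieAlgebra ℝ L] {ρ : K →ₗ⁅ℝ⁆ L} {S : LieSubalgebra ℝ L}
    (h : ∀ i, ρ (x i) ∈ S) : ρ.range ≤ S := by
  rintro _ ⟨y, rfl⟩
  have h1 : y ∈ LieSubalgebra.lieSpan ℝ K (Set.range x) :=
    (KacMoody.lieSpan_compactGenerator cartanMatrix).symm ▸ LieSubalgebra.mem_top y
  have h2 : LieSubalgebra.lieSpan ℝ K (Set.range x) ≤ S.comap ρ :=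
    LieSubalgebra.lieSpan_le.2 (by rintro _ ⟨i, rfl⟩; exact h i)
  exact h2 h1

/-! ### Wedge and symmetric products of covectors -/

/-- The matrix `u^a v_b - v^a u_b`. -/
def wedge (u v : Fin 10 → ℝ) : Matrix (Fin 10) (Fin 10) ℝ := outer u v - outer v u

/-- The matrix `u^a v_b + v^a u_b`. -/
def symProd (u v : Fin 10 → ℝ) : Matrix (Fin 10) (Fin 10) ℝ := outer u v + outer v u

theorem wedge_self (u : Fin 10 → ℝ) : wedge u u = 0 := sub_self _

theorem wedge_swap (u v : Fin 10 → ℝ) : wedge u v = -wedge v u := (neg_sub _ _).symm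

theorem wedge_add_left (u v w : Fin 10 → ℝ) : wedge (u + v) w = wedge u w + wedge v w := by
  simp only [wedge, outer_add_left, outer_add_right]
  abel

theorem wedge_smul_left (c : ℝ) (u v : Fin 10 → ℝ) : wedge (c • u) v = c • wedge u v := by
  simp only [wedge, outer_smul_left, outer_smul_right, smul_sub]

theorem wedge_add_right (u v w : Fin 10 → ℝ) : wedge u (v + w) = wedge u v + wedge u w := by
  simp only [wedge, outer_add_left, outer_add_right]
  abel

theorem wedge_smul_right (c : ℝ) (u v : Fin 10 → ℝ) : wedge u (c • v) = c • wedge u v := by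
  simp only [wedge, outer_smul_left, outer_smul_right, smul_sub]

/-- The wedge product as a bilinear map. -/
def wedgeHom : (Fin 10 → ℝ) →ₗ[ℝ] (Fin 10 → ℝ) →ₗ[ℝ] Matrix (Fin 10) (Fin 10) ℝ :=
  LinearMap.mk₂ ℝ wedge wedge_add_left wedge_smul_left wedge_add_right wedge_smul_right

@[simp] theorem wedgeHom_apply (u v : Fin 10 → ℝ) : wedgeHom u v = wedge u v := rfl

theorem pol_mul_pol_sub (u v : Fin 10 → ℝ) :
    pol u * pol v - pol v * pol u = (1 / 4 * ip u v) • wedge u v := by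
  rw [pol_mul_pol, pol_mul_pol, ip_comm v u, wedge]
  module

theorem lie_wedge_outer (v w p q : Fin 10 → ℝ) :
    wedge v w * outer p q - outer p q * wedge v w =
      ip w p • outer v q - ip v p • outer w q - ip v q • outer p w + ip w q • outer p v := by
  simp only [wedge, sub_mul, mul_sub, outer_mul_outer, ip_comm q]
  abel

theorem lie_wedge_pol {u : Fin 10 → ℝ} (hu : ip u u = 2) (w : Fin 10 → ℝ) :
    wedge w u * pol u - pol u * wedge w u = -(symProd w u - ip u w • outer u u) := by
  have h := lie_wedge_outer w u u u
  rw [hu, ip_comm w u] at h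
  have h1 : wedge w u * pol u - pol u * wedge w u =
      -((1 / 2 : ℝ) • (wedge w u * outer u u - outer u u * wedge w u)) := by
    simp only [pol, mul_sub, sub_mul, mul_smul_comm, smul_mul_assoc, mul_one, one_mul]
    module
  rw [h1, h, symProd]
  module

/-- Since `ip u u = 2`, the tensor `symProd v w - ip v w • outer u u` is traceless. One rotation of
`pol u` produces it for `v = u`, and this second rotation produces it for all `v` and `w`, modulo
tensors already found. -/
theorem lie_wedge_symProd {u : Fin 10 → ℝ} (hu : ip u u = 2) (v w : Fin 10 → ℝ) :
    wedge v u * (symProd w u - ip u w • outer u u) -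
      (symProd w u - ip u w • outer u u) * wedge v u =
    (2 : ℝ) • (symProd v w - ip v w • outer u u) - ip u w • (symProd v u - ip u v • outer u u) -
      ip u v • (symProd w u - ip u w • outer u u) := by
  have h1 := lie_wedge_outer v u w u
  have h2 := lie_wedge_outer v u u w
  have h3 := lie_wedge_outer v u u u
  have h4 : wedge v u * (symProd w u - ip u w • outer u u) -
      (symProd w u - ip u w • outer u u) * wedge v u =
      (wedge v u * outer w u - outer w u * wedge v u) +
      (wedge v u * outer u w - outer u w * wedge v u) -
      ip u w • (wedge v u * outer u u - outer u u * wedge v u) := by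
    simp only [symProd, mul_sub, sub_mul, mul_add, add_mul, mul_smul_comm, smul_mul_assoc, smul_sub]
    abel
  rw [h4, h1, h2, h3, hu, ip_comm v u]
  simp only [symProd]
  module

/-- A basis covector. -/
abbrev unit (a : Fin 10) : Fin 10 → ℝ := Pi.single a 1

theorem ip_unit (a b : Fin 10) : ip (unit a) (unit b) = (if a = b then 1 else 0) - 1 / 9 := by
  rw [ip, Matrix.mulVec_single_one, single_one_dotProduct]
  rfl

theorem sum_smul_unit (u : Fin 10 → ℝ) : ∑ a, u a • unit a = u := by
  ext b
  simp [Finset.sum_apply, Pi.single_apply]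

theorem outer_unit (a b : Fin 10) : outer (unit a) (unit b) = metric * Matrix.single a b 1 := by
  rw [outer, ← Matrix.mul_vecMulVec, Matrix.single_eq_single_vecMulVec_single]

/-- Multiply `G_{ab} = δ_{ab} - 1` by the metric; the covector `1` has all entries equal to one. -/
theorem one_eq_sum_outer : (1 : Matrix (Fin 10) (Fin 10) ℝ) =
    ∑ a, outer (unit a) (unit a) - outer 1 1 := by
  have h : metricLower = ∑ a, Matrix.single a a 1 - Matrix.vecMulVec 1 1 := by
    ext a b
    simp [metricLower, Matrix.sum_apply, Matrix.single_apply, ite_and, -Finset.sum_boole]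
  rw [← metric_mul_metricLower, h, mul_sub, Finset.mul_sum, Matrix.mul_vecMulVec]
  simp only [outer_unit]
  rfl

/-! ### Coefficient spaces in front of a fixed gamma matrix. -/

section Image

variable (Q : LieSubalgebra ℝ (Matrix (Fin 10 × Fin 32) (Fin 10 × Fin 32) ℝ))

/-- The matrices `X` such that `X ⊗ g` lies in the given Lie algebra. -/
def coefficients (g : Matrix (Fin 32) (Fin 32) ℝ) : Submodule ℝ (Matrix (Fin 10) (Fin 10) ℝ) where
  carrier := {X | X ⊗ₖ g ∈ Q}
  add_mem' := by
    intro X Y hX hY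
    simpa only [Set.mem_ofPred_eq, Matrix.add_kronecker] using add_mem hX hY
  zero_mem' := by simp
  smul_mem' := by
    intro c X hX
    simpa only [Set.mem_ofPred_eq, Matrix.smul_kronecker] using Q.smul_mem c hX

variable {Q}

theorem mem_coefficients {g : Matrix (Fin 32) (Fin 32) ℝ} {X : Matrix (Fin 10) (Fin 10) ℝ} :
    X ∈ coefficients Q g ↔ X ⊗ₖ g ∈ Q := Iff.rfl

theorem coefficients_neg (g : Matrix (Fin 32) (Fin 32) ℝ) :
    coefficients Q (-g) = coefficients Q g := by
  ext X
  rw [mem_coefficients, mem_coefficients, ← neg_one_smul ℝ g, Matrix.kronecker_smul, neg_one_smul]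
  exact neg_mem_iff

theorem coefficients_zsmul {g : Matrix (Fin 32) (Fin 32) ℝ} {n : ℤ} (hn : n = 1 ∨ n = -1) :
    coefficients Q (n • g) = coefficients Q g := by
  rcases hn with rfl | rfl
  · rw [one_smul]
  · rw [neg_one_smul, coefficients_neg]

theorem lie_mem_coefficients {g : Matrix (Fin 32) (Fin 32) ℝ} {X Y : Matrix (Fin 10) (Fin 10) ℝ}
    (hX : X ∈ coefficients Q 1) (hY : Y ∈ coefficients Q g) :
    X * Y - Y * X ∈ coefficients Q g := by
  have := Q.lie_mem hX hY
  rwa [lie_kronecker_of_comm (by rw [one_mul, mul_one]), one_mul] at this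

theorem pol_mem_coefficients {u v : Fin 10 → ℝ} (huv : ip u v = -1)
    {g g' : Matrix (Fin 32) (Fin 32) ℝ} (h : g * g' = -(g' * g))
    (hu : pol u ∈ coefficients Q g) (hv : pol v ∈ coefficients Q g') :
    pol (u + v) ∈ coefficients Q (g * g') := by
  have := Q.lie_mem hu hv
  rw [lie_pol_kronecker huv h, ← Matrix.smul_kronecker] at this
  have h2 := (coefficients Q (g * g')).smul_mem (2 : ℝ) this
  rwa [smul_smul, mul_one_div_cancel two_ne_zero, one_smul] at h2

/-- Once `so(9,1) ⊗ 1` is present, the orbit of a polarisation tensor spans all symmetric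
coefficients. -/
theorem symProd_mem_coefficients (h0 : ∀ v w, wedge v w ∈ coefficients Q 1) {u : Fin 10 → ℝ}
    (hu : ip u u = 2) {g : Matrix (Fin 32) (Fin 32) ℝ} (hg : pol u ∈ coefficients Q g) :
    1 ∈ coefficients Q g ∧ ∀ v w, symProd v w ∈ coefficients Q g := by
  have h1 : ∀ w, symProd w u - ip u w • outer u u ∈ coefficients Q g := fun w => by
    have := neg_mem (lie_mem_coefficients (h0 w u) hg)
    rwa [lie_wedge_pol hu, neg_neg] at this
  have h2 : ∀ v w, symProd v w - ip v w • outer u u ∈ coefficients Q g := fun v w => by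
    have h3 := lie_mem_coefficients (h0 v u) (h1 w)
    rw [lie_wedge_symProd hu] at h3
    have h4 := (coefficients Q g).smul_mem (1 / 2 : ℝ)
      (add_mem (add_mem h3 ((coefficients Q g).smul_mem (ip u v) (h1 w)))
        ((coefficients Q g).smul_mem (ip u w) (h1 v)))
    convert h4 using 1
    module
  -- Contracting `h2` with `G_{ab}` through `one_eq_sum_outer` gives the coefficient `10 * (8/9) +
  -- 10/9 = 10`.
  have h3 : (2 : ℝ) • 1 - (10 : ℝ) • outer u u ∈ coefficients Q g := by
    have h4 := sub_mem (sum_mem fun a (_ : a ∈ Finset.univ) => h2 (unit a) (unit a)) (h2 1 1)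
    convert h4 using 1
    have h5 : ip 1 1 = -10 / 9 := by
      rw [ip_eq]
      simp
      norm_num
    rw [Finset.sum_sub_distrib, one_eq_sum_outer, h5, ← Finset.sum_smul]
    simp only [ip_unit, if_true, symProd, ← two_smul ℝ, ← Finset.smul_sum]
    simp only [Finset.sum_const, Finset.card_univ, Fintype.card_fin]
    module
  -- `h3` is traceless but `pol u` has trace `3/2`, so the two are independent combinations of `1`
  -- and `outer u u`; subtracting `20 • pol u` removes `outer u u`.
  have h4 : 1 ∈ coefficients Q g := by
    have h5 := (coefficients Q g).smul_mem (-1 / 3 : ℝ)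
      (sub_mem h3 ((coefficients Q g).smul_mem (20 : ℝ) hg))
    convert h5 using 1
    rw [pol]
    module
  refine ⟨h4, fun v w => ?_⟩
  have h5 : outer u u ∈ coefficients Q g := by
    have := (coefficients Q g).smul_mem (1 / 10 : ℝ)
      (sub_mem ((coefficients Q g).smul_mem (2 : ℝ) h4) h3)
    convert this using 1
    module
  have := add_mem (h2 v w) ((coefficients Q g).smul_mem (ip v w) h5)
  rwa [sub_add_cancel] at this

end Image

/-! ### Polarisations attached to words -/

/-- The sum of the basis covectors along a list. -/
def listVec (l : List (Fin 10)) : Fin 10 → ℝ := (l.map unit).sum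

@[simp] theorem listVec_nil : listVec [] = 0 := rfl

@[simp] theorem listVec_cons (a : Fin 10) (l : List (Fin 10)) :
    listVec (a :: l) = unit a + listVec l := by
  simp [listVec]

theorem listVec_append (l m : List (Fin 10)) : listVec (l ++ m) = listVec l + listVec m := by
  simp [listVec]

theorem ip_zero_left (v : Fin 10 → ℝ) : ip 0 v = 0 := zero_dotProduct _

theorem ip_zero_right (v : Fin 10 → ℝ) : ip v 0 = 0 := by rw [ip_comm, ip_zero_left]

theorem ip_unit_listVec {a : Fin 10} {l : List (Fin 10)} (h : a ∉ l) :
    ip (unit a) (listVec l) = -(l.length / 9) := by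
  induction l with
  | nil => simp [ip_zero_right]
  | cons b l ih =>
    rw [List.mem_cons, not_or] at h
    rw [listVec_cons, ip_add_right, ih h.2, ip_unit, if_neg h.1, List.length_cons]
    push_cast
    ring

theorem ip_listVec_of_disjoint {l m : List (Fin 10)} (h : l.Disjoint m) :
    ip (listVec l) (listVec m) = -(l.length * m.length / 9) := by
  induction l with
  | nil => simp [ip_zero_left]
  | cons a l ih =>
    rw [List.disjoint_cons_left] at h
    rw [listVec_cons, ip_add_left, ih h.2, ip_unit_listVec h.1, List.length_cons]
    push_cast
    ring

theorem ip_listVec_self {l : List (Fin 10)} (h : l.Nodup) :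
    ip (listVec l) (listVec l) = l.length - l.length ^ 2 / 9 := by
  induction l with
  | nil => simp [ip_zero_left]
  | cons a l ih =>
    rw [List.nodup_cons] at h
    rw [listVec_cons, ip_add_left, ip_add_right, ip_add_right, ih h.2, ip_comm (listVec l),
      ip_unit_listVec h.1, ip_unit, if_pos rfl, List.length_cons]
    push_cast
    ring

theorem swapSign_append_left (l l' m : List (Fin 10)) :
    swapSign (l ++ l') m = swapSign l m * swapSign l' m := by
  simp [swapSign]

theorem swapSign_append_right (l m m' : List (Fin 10)) :
    swapSign l (m ++ m') = swapSign l m * swapSign l m' := by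
  simp [swapSign, List.prod_map_mul]

/-- The covectors are the two level-seven roots over the complement of `{a, b, c}` with doubled
index `a` or `b`. Cyclic summation over `a, b, c` cancels the wedges with `1` and leaves `t a b c`;
subtracting it gives `1∧b - 1∧a - a∧b`. Since `1` is the sum of all basis covectors, `1∧b - 1∧a` is
`10 a∧b` modulo the `t`, whence `9 a∧b ∈ N`. -/
theorem wedge_mem_of_complement {N : Submodule ℝ (Matrix (Fin 10) (Fin 10) ℝ)}
    (h : ∀ a b c, a ≠ b → b ≠ c → c ≠ a →
      wedge (1 + unit a - unit b - unit c) (1 + unit b - unit a - unit c) ∈ N)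
    (v w : Fin 10 → ℝ) : wedge v w ∈ N := by
  let t : Fin 10 → Fin 10 → Fin 10 → Matrix (Fin 10) (Fin 10) ℝ := fun a b c =>
    wedge (unit a) (unit b) + wedge (unit b) (unit c) + wedge (unit c) (unit a)
  have hW : ∀ a b c, wedge (1 + unit a - unit b - unit c) (1 + unit b - unit a - unit c) =
      (2 : ℝ) • (wedge 1 (unit b) - wedge 1 (unit a) + wedge (unit b) (unit c) +
        wedge (unit c) (unit a)) := by
    intro a b c
    simp only [← wedgeHom_apply, map_add, map_sub, LinearMap.add_apply, LinearMap.sub_apply]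
    simp only [wedgeHom_apply, wedge_self, wedge_swap _ (1 : Fin 10 → ℝ),
      wedge_swap (unit b) (unit a), wedge_swap (unit c) (unit b), wedge_swap (unit c) (unit a)]
    module
  have h1 : ∀ a b c, a ≠ b → b ≠ c → c ≠ a →
      wedge 1 (unit b) - wedge 1 (unit a) + wedge (unit b) (unit c) +
        wedge (unit c) (unit a) ∈ N := by
    intro a b c hab hbc hca
    have := N.smul_mem (1 / 2 : ℝ) (h a b c hab hbc hca)
    rwa [hW, smul_smul, one_div_mul_cancel two_ne_zero, one_smul] at this
  have h2 : ∀ a b c, t a b c ∈ N := by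
    intro a b c
    by_cases hab : a = b
    · subst hab
      have : t a a c = 0 := by simp only [t, wedge_self, wedge_swap (unit c) (unit a)]; abel
      rw [this]
      exact zero_mem N
    by_cases hbc : b = c
    · subst hbc
      have : t a b b = 0 := by simp only [t, wedge_self, wedge_swap (unit b) (unit a)]; abel
      rw [this]
      exact zero_mem N
    by_cases hca : c = a
    · subst hca
      have : t c b c = 0 := by simp only [t, wedge_self, wedge_swap (unit c) (unit b)]; abel
      rw [this]
      exact zero_mem N
    have := N.smul_mem (1 / 2 : ℝ)
      (add_mem (add_mem (h1 a b c hab hbc hca) (h1 b c a hbc hca hab)) (h1 c a b hca hab hbc))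
    convert this using 1
    simp only [t]
    module
  have hone : (1 : Fin 10 → ℝ) = ∑ c, unit c := by
    rw [← sum_smul_unit 1]
    simp
  have h3 : ∀ a b, wedge (unit a) (unit b) ∈ N := by
    intro a b
    by_cases hab : a = b
    · subst hab
      rw [wedge_self]
      exact zero_mem N
    have hcard : ∃ c, c ∉ ({a, b} : Finset (Fin 10)) := by
      by_contra! hc
      have h5 := Finset.card_le_card (fun c _ => hc c : (Finset.univ : Finset (Fin 10)) ⊆ {a, b})
      have h6 := Finset.card_le_two (a := a) (b := b)
      simp at h5
      lia
    obtain ⟨c, hc⟩ := hcard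
    simp only [Finset.mem_insert, Finset.mem_singleton, not_or] at hc
    have h4 := sub_mem (h1 a b c hab (Ne.symm hc.2) hc.1) (h2 a b c)
    have h5 : wedge 1 (unit b) - wedge 1 (unit a) =
        (10 : ℝ) • wedge (unit a) (unit b) - ∑ c, t a b c := by
      rw [hone]
      simp only [← wedgeHom_apply, map_sum, LinearMap.sum_apply, t, Finset.sum_add_distrib]
      simp only [wedgeHom_apply, wedge_swap (unit b), Finset.sum_neg_distrib, Finset.sum_const,
        Finset.card_univ, Fintype.card_fin]
      module
    have h6 := N.smul_mem (1 / 9 : ℝ)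
      (add_mem h4 (sum_mem fun c (_ : c ∈ Finset.univ) => h2 a b c))
    convert h6 using 1
    rw [h5]
    simp only [t]
    module
  rw [← sum_smul_unit v, ← sum_smul_unit w]
  simp only [← wedgeHom_apply, map_sum, map_smul, LinearMap.sum_apply, LinearMap.smul_apply]
  exact sum_mem fun a _ => N.smul_mem _ (sum_mem fun b _ => N.smul_mem _ (h3 _ _))

theorem listVec_perm {l m : List (Fin 10)} (h : l.Perm m) : listVec l = listVec m :=
  (h.map unit).sum_eq

theorem listVec_toList (s : Finset (Fin 10)) : listVec s.toList = ∑ a ∈ s, unit a :=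
  Finset.sum_map_toList s unit

/-! ### Root vectors in the image and the subalgebra `so(9,1) ⊗ 1`. -/

section RootVectors

variable {Γ : Fin 10 → Matrix (Fin 32) (Fin 32) ℝ} (hΓ : IsGammaSystem Γ)
  {Q : LieSubalgebra ℝ (Matrix (Fin 10 × Fin 32) (Fin 10 × Fin 32) ℝ)}
include hΓ

theorem word_perm {l m : List (Fin 10)} (h : l.Perm m) (hl : l.Nodup) :
    ∃ n : ℤ, (n = 1 ∨ n = -1) ∧ word Γ m = n • word Γ l := by
  induction h with
  | nil => exact ⟨1, Or.inl rfl, (one_smul _ _).symm⟩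
  | cons a _ ih =>
    obtain ⟨n, hn, h⟩ := ih (List.nodup_cons.1 hl).2
    exact ⟨n, hn, by rw [word_cons, word_cons, h, mul_smul_comm]⟩
  | swap a b l =>
    refine ⟨-1, Or.inr rfl, ?_⟩
    have hab : a ≠ b := fun hab => by simp [hab] at hl
    rw [word_cons, word_cons, word_cons, word_cons, ← mul_assoc, hΓ.mul_swap, if_neg hab,
      smul_mul_assoc, mul_assoc]
  | trans h1 _ ih1 ih2 =>
    obtain ⟨n, hn, h⟩ := ih1 hl
    obtain ⟨n', hn', h'⟩ := ih2 (h1.nodup hl)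
    refine ⟨n' * n, ?_, by rw [h', h, smul_smul]⟩
    rcases hn with rfl | rfl <;> rcases hn' with rfl | rfl <;> simp

theorem coefficients_word_perm {l m : List (Fin 10)} (h : l.Perm m) (hl : l.Nodup) :
    coefficients Q (word Γ m) = coefficients Q (word Γ l) := by
  obtain ⟨n, hn, h⟩ := word_perm hΓ h hl
  rw [h, coefficients_zsmul hn]

theorem word_cancel (l m : List (Fin 10)) (a : Fin 10) :
    word Γ ((l ++ [a]) ++ a :: m) = word Γ (l ++ m) := by
  simp only [word_append, word_cons, word_nil, mul_one]
  rw [mul_assoc, ← mul_assoc (Γ a), hΓ.mul_self, one_mul]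

theorem pol_add_mem {u v : Fin 10 → ℝ} {l m : List (Fin 10)} (huv : ip u v = -1)
    (h : swapSign l m = -1) (hu : pol u ∈ coefficients Q (word Γ l))
    (hv : pol v ∈ coefficients Q (word Γ m)) : pol (u + v) ∈ coefficients Q (word Γ (l ++ m)) := by
  rw [word_append]
  refine pol_mem_coefficients huv ?_ hu hv
  rw [word_mul_word hΓ, h, neg_one_smul]

theorem pol_sub_swap {a b : Fin 10} (hab : a ≠ b)
    (h : pol (unit a - unit b) ∈ coefficients Q (word Γ [a, b])) :
    pol (unit b - unit a) ∈ coefficients Q (word Γ [b, a]) := by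
  rw [← pol_neg, neg_sub, coefficients_word_perm hΓ (List.Perm.swap b a []) (by simpa using hab)]
  exact h

theorem pol_sub_trans {a b c : Fin 10} (hab : a ≠ b) (hbc : b ≠ c) (hac : a ≠ c)
    (h : pol (unit a - unit b) ∈ coefficients Q (word Γ [a, b]))
    (h' : pol (unit b - unit c) ∈ coefficients Q (word Γ [b, c])) :
    pol (unit a - unit c) ∈ coefficients Q (word Γ [a, c]) := by
  have h1 := pol_add_mem hΓ ?_ ?_ h h'
  · have h2 := word_cancel hΓ [a] [c] b
    simp only [List.cons_append, List.nil_append] at h1 h2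
    rwa [h2, sub_add_sub_cancel] at h1
  · simp only [sub_eq_add_neg, ip_add_left, ip_add_right, ip_neg_left, ip_neg_right, ip_unit, hab,
      hbc, hac, if_true, if_false]
    norm_num
  · simp [swapSign, hab, hbc, hac]

/-- Adding the root `ε_d - ε_a` exchanges the index `a` for `d`: the repeated letter cancels in the
word, as `ε_a` does in the covector. -/
theorem pol_replace {a d : Fin 10} {l : List (Fin 10)} (hl : l.length = 2) (ha : a ∉ l)
    (hd : d ∉ l) (had : d ≠ a)
    (h : pol (unit d - unit a) ∈ coefficients Q (word Γ [d, a]))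
    (h' : pol (listVec (a :: l)) ∈ coefficients Q (word Γ (a :: l))) :
    pol (listVec (d :: l)) ∈ coefficients Q (word Γ (d :: l)) := by
  have h1 := pol_add_mem hΓ ?_ ?_ h h'
  · have h2 := word_cancel hΓ [d] l a
    simp only [List.cons_append, List.nil_append] at h1 h2
    rwa [h2, listVec_cons, ← add_assoc, sub_add_cancel, ← listVec_cons] at h1
  · rw [listVec_cons]
    simp only [sub_eq_add_neg, ip_add_left, ip_add_right, ip_neg_left, ip_unit, had,
      if_true, if_false, ip_unit_listVec ha, ip_unit_listVec hd]
    norm_num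
  · have e1 : swapSign [d, a] (a :: l) =
        swapSign [d] [a] * swapSign [d] l * (swapSign [a] [a] * swapSign [a] l) := by
      rw [← swapSign_append_right, ← swapSign_append_right, ← swapSign_append_left]
      rfl
    rw [e1, swapSign_of_disjoint (by simpa using hd : [d].Disjoint l),
      swapSign_of_disjoint (by simpa using ha : [a].Disjoint l), hl]
    simp [swapSign, had]

variable (hQ : ∀ i, spinGenerator Γ (simpleRoot i) ∈ Q)
include hQ

theorem pol_root_mem (i : Fin 10) : pol (root i) ∈ coefficients Q (word Γ (simpleWord i)) := by
  have h := hQ i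
  rw [spinGenerator_simpleRoot hΓ] at h
  have h2 := Q.smul_mem (-1 / 2 : ℝ) h
  rw [smul_smul] at h2
  norm_num at h2
  exact h2

/-- Consecutive differences are simple roots. Root addition links index `0` to every other index,
and any two indices are joined through `0`. -/
theorem pol_sub_mem {a b : Fin 10} (hab : a ≠ b) :
    pol (unit a - unit b) ∈ coefficients Q (word Γ [a, b]) := by
  have h0 : ∀ i : Fin 9, pol (unit i.castSucc - unit i.succ) ∈
      coefficients Q (word Γ [i.castSucc, i.succ]) := by
    intro i
    have e1 : ∀ i : Fin 9, simpleWord i.castSucc = [i.castSucc, i.succ] := by decide +kernel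
    have e2 : ∀ (i : Fin 9) a, simpleRoot i.castSucc a =
        (if a = i.castSucc then 1 else 0) - if a = i.succ then 1 else 0 := by decide +kernel
    have e3 : root i.castSucc = unit i.castSucc - unit i.succ := by
      ext a
      simp [root, e2, Pi.single_apply]
    rw [← e3, ← e1]
    exact pol_root_mem hΓ hQ _
  have h1 : ∀ i : Fin 10, i ≠ 0 → pol (unit 0 - unit i) ∈ coefficients Q (word Γ [0, i]) := by
    intro i
    induction i using Fin.induction with
    | zero => exact fun h => absurd rfl h
    | succ i ih =>
      intro hi
      by_cases h : i.castSucc = 0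
      · have := h0 i
        rwa [h] at this
      · exact pol_sub_trans hΓ (Ne.symm h) i.castSucc_lt_succ.ne hi.symm (ih h) (h0 i)
  by_cases ha : a = 0
  · subst ha
    exact h1 b hab.symm
  · by_cases hb : b = 0
    · subst hb
      exact pol_sub_swap hΓ hab.symm (h1 a ha)
    · exact pol_sub_trans hΓ ha (Ne.symm hb) hab (pol_sub_swap hΓ (Ne.symm ha) (h1 a ha)) (h1 b hb)

theorem pol_listVec_three {l : List (Fin 10)} (hl : l.Nodup) (h3 : l.length = 3) :
    pol (listVec l) ∈ coefficients Q (word Γ l) := by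
  have perm : ∀ {l m : List (Fin 10)}, l.Perm m → l.Nodup →
      pol (listVec l) ∈ coefficients Q (word Γ l) →
      pol (listVec m) ∈ coefficients Q (word Γ m) := fun h hl h1 => by
    rwa [← listVec_perm h, coefficients_word_perm hΓ h hl]
  have repl : ∀ {a b c : Fin 10} (d : Fin 10), a ≠ b → a ≠ c → b ≠ c → d ≠ a → d ≠ b → d ≠ c →
      pol (listVec [a, b, c]) ∈ coefficients Q (word Γ [a, b, c]) →
      pol (listVec [b, c, d]) ∈ coefficients Q (word Γ [b, c, d]) := by
    intro a b c d hab hac hbc hda hdb hdc h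
    have h1 : pol (listVec [d, b, c]) ∈ coefficients Q (word Γ [d, b, c]) :=
      pol_replace hΓ rfl (by simp [hab, hac]) (by simp [hdb, hdc]) hda (pol_sub_mem hΓ hQ hda) h
    exact perm (List.perm_append_comm (l₁ := [d]) (l₂ := [b, c])) (by simp [hdb, hdc, hbc]) h1
  have base : pol (listVec [7, 8, 9]) ∈ coefficients Q (word Γ [7, 8, 9]) := by
    have e3 : root 9 = listVec [7, 8, 9] := by
      have e2 : ∀ a, simpleRoot 9 a = (if a = 7 then 1 else 0) + ((if a = 8 then 1 else 0) +
          if a = 9 then 1 else 0) := by decide +kernel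
      ext a
      simp [root, e2, Pi.single_apply]
    rw [← e3]
    exact pol_root_mem hΓ hQ 9
  obtain ⟨a, b, c, rfl⟩ := List.length_eq_three.1 h3
  -- A substitution may only bring in an index absent from the current triple, and `{a, b, c}` may
  -- meet `{7, 8, 9}`. The passage therefore goes through a triple disjoint from both.
  have hcard : 2 < (({7, 8, 9, a, b, c} : Finset (Fin 10))ᶜ).card := by
    rw [Finset.card_compl, Fintype.card_fin]
    have := Finset.card_le_six (a := (7 : Fin 10)) (b := 8) (c := 9) (d := a) (e := b) (f := c)
    lia
  obtain ⟨p, hp, q, hq, r, hr, hpq, hpr, hqr⟩ := Finset.two_lt_card.1 hcard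
  simp only [Finset.mem_compl, Finset.mem_insert, Finset.mem_singleton, not_or] at hp hq hr
  simp only [List.nodup_cons, List.mem_cons, List.not_mem_nil, or_false, not_or] at hl
  obtain ⟨hp7, hp8, hp9, hpa, hpb, hpc⟩ := hp
  obtain ⟨hq7, hq8, hq9, hqa, hqb, hqc⟩ := hq
  obtain ⟨hr7, hr8, hr9, hra, hrb, hrc⟩ := hr
  obtain ⟨⟨hab, hac⟩, hbc, -⟩ := hl
  have s1 := repl p (by decide) (by decide) (by decide) hp7 hp8 hp9 base
  have s2 := repl q (by decide) (Ne.symm hp8) (Ne.symm hp9) hq8 hq9 (Ne.symm hpq) s1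
  have s3 := repl r (Ne.symm hp9) (Ne.symm hq9) hpq hr9 (Ne.symm hpr) (Ne.symm hqr) s2
  have s4 := repl a hpq hpr hqr (Ne.symm hpa) (Ne.symm hqa) (Ne.symm hra) s3
  have s5 := repl b hqr hqa hra (Ne.symm hqb) (Ne.symm hrb) (Ne.symm hab) s4
  exact repl c hra hrb hab (Ne.symm hrc) (Ne.symm hac) (Ne.symm hbc) s5

theorem pol_listVec_six {l : List (Fin 10)} (hl : l.Nodup) (h6 : l.length = 6) :
    pol (listVec l) ∈ coefficients Q (word Γ l) := by
  have e : l.take 3 ++ l.drop 3 = l := List.take_append_drop 3 l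
  have hn := hl
  rw [← e, List.nodup_append'] at hn
  obtain ⟨h1, h2, h12⟩ := hn
  have l1 : (l.take 3).length = 3 := by simp [h6]
  have l2 : (l.drop 3).length = 3 := by simp [h6]
  rw [← e, listVec_append]
  refine pol_add_mem hΓ ?_ ?_ (pol_listVec_three hΓ hQ h1 l1) (pol_listVec_three hΓ hQ h2 l2)
  · rw [ip_listVec_of_disjoint h12, l1, l2]
    norm_num
  · rw [swapSign_of_disjoint h12, l1, l2]
    norm_num

/-- Add a six-index root and a three-index root that share exactly the index `a`. The covector
counts `a` twice while the letter disappears from the word, so different choices of `a` give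
different roots with the same gamma word. -/
theorem pol_listVec_seven {l : List (Fin 10)} (hl : l.Nodup) (h7 : l.length = 7) {a : Fin 10}
    (ha : a ∉ l) : pol (listVec l + (2 : ℝ) • unit a) ∈ coefficients Q (word Γ l) := by
  have e : l.take 5 ++ l.drop 5 = l := List.take_append_drop 5 l
  have hn := hl
  rw [← e, List.nodup_append'] at hn
  rw [← e, List.mem_append, not_or] at ha
  have l1 : (l.take 5).length = 5 := by simp [h7]
  have l2 : (l.drop 5).length = 2 := by simp [h7]
  rw [← e, listVec_append]
  generalize l.take 5 = m at *
  generalize l.drop 5 = m' at *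
  obtain ⟨h1, h2, h12⟩ := hn
  have hma : m.Disjoint [a] := by simpa using ha.1
  have key := pol_add_mem hΓ (u := listVec (m ++ [a])) (v := listVec (a :: m'))
    (l := m ++ [a]) (m := a :: m') ?_ ?_
    (pol_listVec_six hΓ hQ (h1.append (List.nodup_singleton a) hma) (by simp [l1]))
    (pol_listVec_three hΓ hQ (List.nodup_cons.2 ⟨ha.2, h2⟩) (by simp [l2]))
  · rw [word_cancel hΓ] at key
    convert key using 2
    simp only [listVec_append, listVec_cons, listVec_nil]
    module
  · simp only [listVec_append, listVec_cons, listVec_nil, add_zero, ip_add_left, ip_add_right,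
      ip_comm (listVec m) (unit a), ip_unit_listVec ha.1, ip_unit_listVec ha.2,
      ip_listVec_of_disjoint h12, ip_unit, l1, l2]
    norm_num
  · have e1 : swapSign (m ++ [a]) (a :: m') =
        swapSign m [a] * swapSign m m' * (swapSign [a] [a] * swapSign [a] m') := by
      rw [← swapSign_append_right, ← swapSign_append_right, ← swapSign_append_left]
      rfl
    rw [e1, swapSign_of_disjoint hma, swapSign_of_disjoint h12,
      swapSign_of_disjoint (by simpa using ha.2 : [a].Disjoint m'), l1, l2]
    simp [swapSign]

/-- Bracket two level-seven roots with the same word: the words multiply to `-1`, and the commutator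
of the polarisations is a multiple of their wedge, nonzero because the inner product is `-2`. -/
theorem wedge_mem (v w : Fin 10 → ℝ) : wedge v w ∈ coefficients Q 1 := by
  refine wedge_mem_of_complement (fun a b c hab hbc hca => ?_) v w
  set s : Finset (Fin 10) := {a, b, c} with hs
  have hcard : s.card = 3 := Finset.card_eq_three.2 ⟨a, b, c, hab, hca.symm, hbc, rfl⟩
  set l := sᶜ.toList with hl
  have hn : l.Nodup := Finset.nodup_toList _
  have h7 : l.length = 7 := by
    rw [hl, Finset.length_toList, Finset.card_compl, hcard, Fintype.card_fin]
  have hsum : listVec l = 1 - unit a - unit b - unit c := by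
    have h1 : ∑ x ∈ s, unit x = unit a + (unit b + unit c) := by
      rw [hs, Finset.sum_insert (by simp [hab, hca.symm]), Finset.sum_pair hbc]
    have h2 : (∑ x, unit x) = (1 : Fin 10 → ℝ) := by
      rw [← sum_smul_unit 1]
      simp
    have h3 := Finset.sum_compl_add_sum s unit
    rw [h1, h2] at h3
    rw [hl, listVec_toList, ← h3]
    abel
  have ha : a ∉ l := by simp [hl, hs]
  have hb : b ∉ l := by simp [hl, hs]
  have hlie := Q.lie_mem (pol_listVec_seven hΓ hQ hn h7 ha) (pol_listVec_seven hΓ hQ hn h7 hb)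
  have hip : ip (listVec l + (2 : ℝ) • unit a) (listVec l + (2 : ℝ) • unit b) = -2 := by
    simp only [ip_add_left, ip_add_right, ip_smul_left, ip_smul_right, ip_listVec_self hn,
      ip_comm (listVec l) (unit _), ip_unit_listVec ha, ip_unit_listVec hb, ip_unit, if_neg hab, h7]
    norm_num
  have hsq : word Γ l * word Γ l = -1 := by
    rw [word_mul_self hΓ hn, h7, show (-1 : ℤ) ^ (Nat.choose 7 2) = -1 by decide, neg_one_smul]
  rw [lie_kronecker_of_comm rfl, pol_mul_pol_sub, hip, hsq, ← mem_coefficients,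
    coefficients_neg] at hlie
  have h := (coefficients Q 1).smul_mem (-2 : ℝ) hlie
  rw [smul_smul] at h
  norm_num at h
  convert h using 2 <;> rw [hsum] <;> module

/-- All symmetric coefficients occur in front of the antisymmetric words. -/
theorem symProd_mem_word {l : List (Fin 10)} (hl : l.Nodup)
    (hs : (-1 : ℤ) ^ (l.length.choose 2) = -1) :
    1 ∈ coefficients Q (word Γ l) ∧ ∀ v w, symProd v w ∈ coefficients Q (word Γ l) := by
  have h0 := wedge_mem hΓ hQ
  have h3 : ∀ {l : List (Fin 10)}, l.Nodup → l.length = 3 →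
      1 ∈ coefficients Q (word Γ l) ∧ ∀ v w, symProd v w ∈ coefficients Q (word Γ l) :=
    fun hl h => symProd_mem_coefficients h0
      (by rw [ip_listVec_self hl, h]; norm_num) (pol_listVec_three hΓ hQ hl h)
  have h7 : ∀ {l : List (Fin 10)}, l.Nodup → l.length = 7 →
      1 ∈ coefficients Q (word Γ l) ∧ ∀ v w, symProd v w ∈ coefficients Q (word Γ l) := by
    intro l hl h
    obtain ⟨a, ha⟩ : ∃ a, a ∉ l := by
      by_contra! hc
      have h1 : (Finset.univ : Finset (Fin 10)) ⊆ l.toFinset :=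
        fun a _ => List.mem_toFinset.2 (hc a)
      have h2 := Finset.card_le_card h1
      have h3 := l.toFinset_card_le
      simp at h2
      lia
    refine symProd_mem_coefficients h0 ?_ (pol_listVec_seven hΓ hQ hl h ha)
    simp only [ip_add_left, ip_add_right, ip_smul_left, ip_smul_right, ip_listVec_self hl,
      ip_comm (listVec l) (unit _), ip_unit_listVec ha, ip_unit, h]
    norm_num
  have hlen : l.length = 2 ∨ l.length = 3 ∨ l.length = 6 ∨ l.length = 7 ∨ l.length = 10 := by
    have h1 : ∀ n : Fin 11, (-1 : ℤ) ^ (Nat.choose n 2) = -1 →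
        n.1 = 2 ∨ n.1 = 3 ∨ n.1 = 6 ∨ n.1 = 7 ∨ n.1 = 10 := by decide
    have h2 : l.length ≤ 10 := by simpa using hl.length_le_card
    exact h1 ⟨l.length, by lia⟩ hs
  rcases hlen with h | h | h | h | h
  · obtain ⟨a, b, rfl⟩ := List.length_eq_two.1 h
    have hab : a ≠ b := by simpa using hl
    refine symProd_mem_coefficients h0 ?_ (pol_sub_mem hΓ hQ hab)
    simp only [sub_eq_add_neg, ip_add_left, ip_add_right, ip_neg_left, ip_neg_right, ip_unit, hab,
      hab.symm, if_true, if_false]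
    norm_num
  · exact h3 hl h
  · exact symProd_mem_coefficients h0 (by rw [ip_listVec_self hl, h]; norm_num)
      (pol_listVec_six hΓ hQ hl h)
  · exact h7 hl h
  -- The full word comes from no root vector used here. It is the product of anticommuting words of
  -- lengths seven and three; bracketing with `1 ⊗` the short word carries every coefficient of the
  -- long one over.
  · have e : l.take 7 ++ l.drop 7 = l := List.take_append_drop 7 l
    have hn := hl
    rw [← e, List.nodup_append'] at hn
    obtain ⟨n1, n2, h12⟩ := hn
    have l1 : (l.take 7).length = 7 := by simp [h]
    have l2 : (l.drop 7).length = 3 := by simp [h]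
    have hsw : word Γ (l.take 7) * word Γ (l.drop 7) =
        -(word Γ (l.drop 7) * word Γ (l.take 7)) := by
      rw [word_mul_word_of_disjoint hΓ h12, l1, l2]
      norm_num
    have key : ∀ X ∈ coefficients Q (word Γ (l.take 7)), X ∈ coefficients Q (word Γ l) := by
      intro X hX
      have h4 := Q.lie_mem hX (h3 n2 l2).1
      rw [lie_kronecker_of_anticomm hsw, ← word_append, e, mul_one, one_mul] at h4
      have h5 := (coefficients Q (word Γ l)).smul_mem (1 / 2 : ℝ) h4
      convert h5 using 1
      module
    exact ⟨key _ (h7 n1 l1).1, fun v w => key _ ((h7 n1 l1).2 v w)⟩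

end RootVectors

/-! ### The gamma words as a basis of the `32 × 32` matrices. -/

section Span

variable {Γ : Fin 10 → Matrix (Fin 32) (Fin 32) ℝ} (hΓ : IsGammaSystem Γ)

theorem swapSign_singleton_toList (a : Fin 10) (s : Finset (Fin 10)) :
    swapSign [a] s.toList = (-1) ^ (s.erase a).card := by
  simp only [swapSign, List.map_cons, List.map_nil, List.prod_cons, List.prod_nil, mul_one]
  rw [Finset.prod_map_toList s fun b => if a = b then (1 : ℤ) else -1, Finset.prod_ite]
  simp only [Finset.prod_const_one, one_mul, Finset.prod_const, Finset.filter_ne]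

/-- The sign is the parity of the sizes after erasing `a`. If `|s| + |t|` is even, choose `a` in
exactly one set; if odd, in both or neither. The latter is impossible only for `t = sᶜ`, excluded
because `10` is even. -/
theorem exists_swapSign_mul_eq_neg_one {s t : Finset (Fin 10)} (hst : s ≠ t) :
    ∃ a, swapSign [a] s.toList * swapSign [a] t.toList = -1 := by
  simp only [swapSign_singleton_toList, ← pow_add]
  rcases Nat.even_or_odd (s.card + t.card) with h | h
  · obtain ⟨a, ha⟩ : ∃ a, ¬(a ∈ s ↔ a ∈ t) := by
      by_contra! hc
      exact hst (Finset.ext hc)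
    refine ⟨a, Odd.neg_one_pow ?_⟩
    by_cases has : a ∈ s
    · have hat : a ∉ t := fun hat => ha ⟨fun _ => hat, fun _ => has⟩
      have h1 := Finset.card_erase_add_one has
      rw [Finset.erase_eq_of_notMem hat]
      rw [← h1] at h
      grind
    · have hat : a ∈ t := by
        by_contra hat
        exact ha ⟨fun h => absurd h has, fun h => absurd h hat⟩
      have h1 := Finset.card_erase_add_one hat
      rw [Finset.erase_eq_of_notMem has]
      rw [← h1] at h
      grind
  · obtain ⟨a, ha⟩ : ∃ a, a ∈ s ↔ a ∈ t := by
      by_contra! hc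
      have h1 : t = sᶜ := by
        ext a
        rw [Finset.mem_compl]
        have := hc a
        tauto
      have h2 := s.card_add_card_compl
      rw [← h1, Fintype.card_fin] at h2
      rw [h2] at h
      exact absurd h (by decide)
    refine ⟨a, Odd.neg_one_pow ?_⟩
    by_cases has : a ∈ s
    · have h1 := Finset.card_erase_add_one has
      have h2 := Finset.card_erase_add_one (ha.1 has)
      rw [← h1, ← h2] at h
      grind
    · rwa [Finset.erase_eq_of_notMem has, Finset.erase_eq_of_notMem (fun h => has (ha.2 h))]

include hΓ

/-- Some `Γ a` anticommutes with the product, so conjugation by it reverses the sign of the trace.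
-/
theorem trace_word_mul_word {s t : Finset (Fin 10)} (hst : s ≠ t) :
    (word Γ s.toList * word Γ t.toList).trace = 0 := by
  obtain ⟨a, ha⟩ := exists_swapSign_mul_eq_neg_one hst
  have conj : ∀ l, Γ a * word Γ l = swapSign [a] l • (word Γ l * Γ a) := fun l => by
    have := word_mul_word hΓ [a] l
    rwa [word_cons, word_nil, mul_one] at this
  have h1 : Γ a * (word Γ s.toList * word Γ t.toList) =
      -(word Γ s.toList * word Γ t.toList * Γ a) := by
    rw [← mul_assoc, conj, smul_mul_assoc, mul_assoc, conj, mul_smul_comm, smul_smul, ha,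
      neg_one_smul, mul_assoc]
  have h2 := congrArg (fun M => (M * Γ a).trace) h1
  simp only [neg_mul, Matrix.trace_neg, mul_assoc (word Γ s.toList * word Γ t.toList),
    hΓ.mul_self, mul_one] at h2
  rw [Matrix.trace_mul_comm, ← mul_assoc, hΓ.mul_self, one_mul] at h2
  linarith

theorem span_word : Submodule.span ℝ
    (Set.range fun s : Finset (Fin 10) => word Γ s.toList) = ⊤ := by
  have hli : LinearIndependent ℝ fun s : Finset (Fin 10) => word Γ s.toList := by
    rw [Fintype.linearIndependent_iff]
    intro g hg t
    have h1 := congrArg (fun M => (word Γ t.toList.reverse * M).trace) hg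
    simp only [Finset.mul_sum, Matrix.trace_sum, mul_smul_comm, Matrix.trace_smul, mul_zero,
      Matrix.trace_zero] at h1
    rw [Finset.sum_eq_single t, word_reverse_mul_word hΓ] at h1
    · simpa using h1
    · intro s _ hst
      rw [word_reverse hΓ t.nodup_toList, smul_mul_assoc, Matrix.trace_smul,
        trace_word_mul_word hΓ (Ne.symm hst), smul_zero, smul_zero]
    · simp
  -- The count is `2 ^ 10 = 32 ^ 2`.
  refine hli.span_eq_top_of_card_eq_finrank' ?_
  simp [Module.finrank_matrix]

/-- The antisymmetric matrices are spanned by the antisymmetric words. -/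
theorem antisymm_mem {N : Submodule ℝ (Matrix (Fin 32) (Fin 32) ℝ)}
    (hN : ∀ l : List (Fin 10), l.Nodup → (-1 : ℤ) ^ (l.length.choose 2) = -1 → word Γ l ∈ N)
    {M : Matrix (Fin 32) (Fin 32) ℝ} (hM : Mᵀ = -M) : M ∈ N := by
  have h1 : M ∈ Submodule.span ℝ (Set.range fun s : Finset (Fin 10) => word Γ s.toList) := by
    rw [span_word hΓ]
    exact Submodule.mem_top
  obtain ⟨c, hc⟩ := (Submodule.mem_span_range_iff_exists_fun ℝ).1 h1
  have h2 : M = ∑ s, (c s / 2) • (word Γ s.toList - (word Γ s.toList)ᵀ) := by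
    have h3 : M = (1 / 2 : ℝ) • (M - Mᵀ) := by
      rw [hM]
      module
    rw [h3, ← hc, Matrix.transpose_sum, ← Finset.sum_sub_distrib, Finset.smul_sum]
    refine Finset.sum_congr rfl fun s _ => ?_
    rw [Matrix.transpose_smul]
    module
  rw [h2]
  refine sum_mem fun s _ => N.smul_mem _ ?_
  rw [transpose_word hΓ, word_reverse hΓ s.nodup_toList]
  rcases neg_one_pow_eq_or ℤ (s.toList.length.choose 2) with h | h
  · rw [h, one_smul, sub_self]
    exact zero_mem N
  · have := hN _ s.nodup_toList h
    exact sub_mem this (zsmul_mem this _)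

end Span

/-! ### The image of the spin-3/2 representation -/

theorem metricLower_mul_metric : metricLower * metric = 1 :=
  mul_eq_one_comm.1 metric_mul_metricLower

theorem metricLower_transpose : metricLowerᵀ = metricLower := by
  ext a b
  simp [metricLower, eq_comm]

theorem gram_transpose : gramᵀ = gram := by
  rw [gram, ← Matrix.kroneckerMap_transpose, metricLower_transpose, Matrix.transpose_one]

theorem metricLower_mul_outer (u v : Fin 10 → ℝ) :
    metricLower * outer u v = Matrix.vecMulVec u v := by
  rw [outer, Matrix.mul_vecMulVec, Matrix.mulVec_mulVec, metricLower_mul_metric, Matrix.one_mulVec]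

theorem metricLower_mul_pol (u : Fin 10 → ℝ) :
    (pol u)ᵀ * metricLower = metricLower * pol u := by
  have h : (metricLower * pol u)ᵀ = metricLower * pol u := by
    rw [pol, mul_sub, mul_smul_comm, mul_smul_comm, metricLower_mul_outer, mul_one,
      Matrix.transpose_sub, Matrix.transpose_smul, Matrix.transpose_smul, metricLower_transpose,
      Matrix.transpose_vecMulVec]
  rwa [Matrix.transpose_mul, metricLower_transpose] at h

theorem mem_skewAdjoint_iff {M : Matrix (Fin 10 × Fin 32) (Fin 10 × Fin 32) ℝ} :
    M ∈ skewAdjointMatricesLieSubalgebra gram ↔ Mᵀ * gram = -(gram * M) := by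
  rw [mem_skewAdjointMatricesLieSubalgebra, mem_skewAdjointMatricesSubmodule, ← mul_neg]
  rfl

theorem mem_skewAdjoint_iff_form {M : Matrix (Fin 10 × Fin 32) (Fin 10 × Fin 32) ℝ} :
    M ∈ skewAdjointMatricesLieSubalgebra gram ↔
      ∀ φ ψ, form (M.mulVec φ) ψ + form φ (M.mulVec ψ) = 0 := by
  have h : ∀ φ ψ, form (M.mulVec φ) ψ + form φ (M.mulVec ψ) =
      Matrix.toBilin' (Mᵀ * gram + gram * M) φ ψ := by
    intro φ ψ
    simp only [form, Matrix.toBilin'_apply', Matrix.add_mulVec, dotProduct_add,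
      ← Matrix.mulVec_mulVec, Matrix.dotProduct_mulVec φ Mᵀ, Matrix.vecMul_transpose]
  rw [mem_skewAdjoint_iff, ← add_eq_zero_iff_eq_neg]
  simp only [h]
  constructor
  · intro h0 φ ψ
    rw [h0]
    simp
  · intro h0
    refine Matrix.toBilin'.injective ?_
    rw [map_zero]
    ext φ ψ
    simp only [LinearMap.comp_apply]
    rw [h0]
    simp

section Range

variable {Γ : Fin 10 → Matrix (Fin 32) (Fin 32) ℝ} (hΓ : IsGammaSystem Γ)
include hΓ

theorem spinGenerator_mem_skewAdjoint (i : Fin 10) :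
    spinGenerator Γ (simpleRoot i) ∈ skewAdjointMatricesLieSubalgebra gram := by
  have h1 : ∀ i, (simpleWord i).Nodup ∧ (-1 : ℤ) ^ ((simpleWord i).length.choose 2) = -1 := by
    decide +kernel
  have h2 : (word Γ (simpleWord i))ᵀ = (-1 : ℝ) • word Γ (simpleWord i) := by
    rw [transpose_word hΓ, word_reverse hΓ (h1 i).1, (h1 i).2]
    simp
  rw [mem_skewAdjoint_iff, spinGenerator_simpleRoot hΓ, gram, Matrix.transpose_smul,
    ← Matrix.kroneckerMap_transpose, h2, smul_mul_assoc, mul_smul_comm, ← Matrix.mul_kronecker_mul,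
    ← Matrix.mul_kronecker_mul, metricLower_mul_pol, mul_one, one_mul, Matrix.kronecker_smul]
  module

/-- With an index lowered, a skew-adjoint matrix is antisymmetric in the pair (vector, spinor)
index, hence a sum of symmetric ⊗ antisymmetric and antisymmetric ⊗ symmetric parts. Antisymmetric
words supply the first kind and brackets between these supply the second. -/
theorem skewAdjoint_le {Q : LieSubalgebra ℝ (Matrix (Fin 10 × Fin 32) (Fin 10 × Fin 32) ℝ)}
    (hQ : ∀ i, spinGenerator Γ (simpleRoot i) ∈ Q) : skewAdjointMatricesLieSubalgebra gram ≤ Q := by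
  have sym : ∀ u v (M : Matrix (Fin 32) (Fin 32) ℝ), Mᵀ = -M → symProd u v ⊗ₖ M ∈ Q := by
    intro u v M hM
    let N : Submodule ℝ (Matrix (Fin 32) (Fin 32) ℝ) :=
      { carrier := {M | symProd u v ⊗ₖ M ∈ Q}
        add_mem' := by
          intro X Y hX hY
          simpa only [Set.mem_ofPred_eq, Matrix.kronecker_add] using add_mem hX hY
        zero_mem' := by simp
        smul_mem' := by
          intro c X hX
          simpa only [Set.mem_ofPred_eq, Matrix.kronecker_smul] using Q.smul_mem c hX }
    exact antisymm_mem hΓ (N := N) (fun l hl h => (symProd_mem_word hΓ hQ hl h).2 u v) hM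
  have out : ∀ u (M : Matrix (Fin 32) (Fin 32) ℝ), Mᵀ = -M → outer u u ⊗ₖ M ∈ Q := by
    intro u M hM
    have := Q.smul_mem (1 / 2 : ℝ) (sym u u M hM)
    rwa [← Matrix.smul_kronecker, symProd, ← two_smul ℝ, smul_smul,
      one_div_mul_cancel two_ne_zero, one_smul] at this
  have sq : ∀ a b (M M' : Matrix (Fin 32) (Fin 32) ℝ), Mᵀ = -M → M'ᵀ = -M' →
      wedge (unit a) (unit b) ⊗ₖ (M * M' + M' * M) ∈ Q := by
    intro a b M M' hM hM'
    by_cases hab : a = b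
    · subst hab
      simp [wedge_self]
    have h1 := add_mem (Q.lie_mem (out (unit a) M hM) (out (unit b) M' hM'))
      (Q.lie_mem (out (unit a) M' hM') (out (unit b) M hM))
    -- The symmetrised bracket is `ip (unit a) (unit b) = -1/9` times the target.
    have h2 := Q.smul_mem (-9 : ℝ) h1
    convert h2 using 1
    simp only [LieRing.of_associative_ring_bracket, ← Matrix.mul_kronecker_mul, outer_mul_outer,
      ip_unit, if_neg hab, if_neg (Ne.symm hab), Matrix.smul_kronecker, wedge,
      Matrix.kronecker_add]
    simp only [sub_eq_add_neg, ← neg_one_smul ℝ (outer _ _), Matrix.add_kronecker,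
      Matrix.smul_kronecker]
    module
  have anti : ∀ s t : Fin 32, (Matrix.single s t (1 : ℝ) - Matrix.single t s 1)ᵀ =
      -(Matrix.single s t 1 - Matrix.single t s 1) := by
    intro s t
    rw [Matrix.transpose_sub, Matrix.transpose_single, Matrix.transpose_single, neg_sub]
  have offdiag : ∀ a b (s t : Fin 32), s ≠ t → wedge (unit a) (unit b) ⊗ₖ
      (Matrix.single s t (1 : ℝ) + Matrix.single t s 1) ∈ Q := by
    intro a b s t hst
    obtain ⟨r, hr⟩ : ∃ r, r ∉ ({s, t} : Finset (Fin 32)) := by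
      by_contra! hc
      have h5 := Finset.card_le_card (fun c _ => hc c : (Finset.univ : Finset (Fin 32)) ⊆ {s, t})
      have h6 := Finset.card_le_two (a := s) (b := t)
      simp at h5
      lia
    simp only [Finset.mem_insert, Finset.mem_singleton, not_or] at hr
    have h1 := sq a b _ _ (anti s r) (anti r t)
    have h2 : (Matrix.single s r (1 : ℝ) - Matrix.single r s 1) *
        (Matrix.single r t 1 - Matrix.single t r 1) = Matrix.single s t 1 := by
      simp [sub_mul, mul_sub, Matrix.single_mul_single_of_ne, hr.2, hst, Ne.symm hr.1]
    have h3 : (Matrix.single r t 1 - Matrix.single t r 1) *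
        (Matrix.single s r (1 : ℝ) - Matrix.single r s 1) = Matrix.single t s 1 := by
      simp [sub_mul, mul_sub, Matrix.single_mul_single_of_ne, hr.1, hst.symm, Ne.symm hr.2]
    rwa [h2, h3] at h1
  -- Squares of elementary antisymmetric matrices give only the sums `E_ss + E_tt`; with three
  -- distinct indices, `(ss + tt) + (ss + rr) - (tt + rr)` isolates `2 E_ss`.
  have diag : ∀ a b (s : Fin 32), wedge (unit a) (unit b) ⊗ₖ
      (Matrix.single s s (1 : ℝ) + Matrix.single s s 1) ∈ Q := by
    intro a b s
    have two : ∀ s t : Fin 32, s ≠ t → wedge (unit a) (unit b) ⊗ₖ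
        ((-2 : ℝ) • (Matrix.single s s (1 : ℝ) + Matrix.single t t 1)) ∈ Q := by
      intro s t hst
      have h1 := sq a b _ _ (anti s t) (anti s t)
      have h2 : (Matrix.single s t (1 : ℝ) - Matrix.single t s 1) *
          (Matrix.single s t 1 - Matrix.single t s 1) =
          -(Matrix.single s s 1 + Matrix.single t t 1) := by
        rw [sub_mul, mul_sub, mul_sub, Matrix.single_mul_single_same,
          Matrix.single_mul_single_same, Matrix.single_mul_single_of_ne _ _ _ _ hst.symm,
          Matrix.single_mul_single_of_ne _ _ _ _ hst, mul_one]
        abel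
      rw [h2] at h1
      convert h1 using 2
      module
    obtain ⟨t, r, ht, hr, htr⟩ : ∃ t r : Fin 32, s ≠ t ∧ s ≠ r ∧ t ≠ r := by
      have : ∀ s : Fin 32, s ≠ s + 1 ∧ s ≠ s + 2 ∧ s + 1 ≠ s + 2 := by decide
      exact ⟨s + 1, s + 2, this s⟩
    have h1 := Q.smul_mem (-1 / 2 : ℝ) (sub_mem (add_mem (two s t ht) (two s r hr)) (two t r htr))
    convert h1 using 1
    simp only [Matrix.kronecker_smul, Matrix.kronecker_add]
    module
  intro M hM
  rw [mem_skewAdjoint_iff] at hM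
  set N := gram * M with hN
  have hNt : Nᵀ = -N := by
    rw [hN, Matrix.transpose_mul, gram_transpose, hM]
  let k : Fin 10 × Fin 32 → Fin 10 × Fin 32 → Matrix (Fin 10 × Fin 32) (Fin 10 × Fin 32) ℝ :=
    fun p q => outer (unit p.1) (unit q.1) ⊗ₖ Matrix.single p.2 q.2 (1 : ℝ)
  have hMk : M = ∑ p, ∑ q, N p q • k p q := by
    have h1 : (metric ⊗ₖ (1 : Matrix (Fin 32) (Fin 32) ℝ)) * gram = 1 := by
      rw [gram, ← Matrix.mul_kronecker_mul, metric_mul_metricLower, mul_one,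
        Matrix.one_kronecker_one]
    have h2 : M = (metric ⊗ₖ (1 : Matrix (Fin 32) (Fin 32) ℝ)) * N := by
      rw [hN, ← mul_assoc, h1, one_mul]
    conv_lhs => rw [h2, Matrix.matrix_eq_sum_single N]
    simp only [Finset.mul_sum]
    refine Finset.sum_congr rfl fun p _ => Finset.sum_congr rfl fun q _ => ?_
    obtain ⟨a, s⟩ := p
    obtain ⟨b, t⟩ := q
    have h3 : Matrix.single (a, s) (b, t) (N (a, s) (b, t)) = N (a, s) (b, t) •
        (Matrix.single a b (1 : ℝ) ⊗ₖ Matrix.single s t (1 : ℝ)) := by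
      rw [Matrix.single_kronecker_single, Matrix.smul_single]
      simp
    rw [h3, mul_smul_comm, ← Matrix.mul_kronecker_mul, one_mul]
    simp only [k, outer_unit]
  -- Antisymmetry of `N` replaces `k p q` by `½ (k p q - k q p)`, and twice that difference splits
  -- as symmetric ⊗ antisymmetric plus wedge ⊗ symmetric.
  have hMk' : M = (1 / 4 : ℝ) • ∑ p, ∑ q, N p q •
      (symProd (unit p.1) (unit q.1) ⊗ₖ (Matrix.single p.2 q.2 (1 : ℝ) - Matrix.single q.2 p.2 1) +
       wedge (unit p.1) (unit q.1) ⊗ₖ (Matrix.single p.2 q.2 (1 : ℝ) +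
         Matrix.single q.2 p.2 1)) := by
    have h1 : M = -∑ p, ∑ q, N p q • k q p := by
      rw [hMk, Finset.sum_comm, ← Finset.sum_neg_distrib]
      refine Finset.sum_congr rfl fun p _ => ?_
      rw [← Finset.sum_neg_distrib]
      refine Finset.sum_congr rfl fun q _ => ?_
      have h2 : N q p = -N p q := by
        have := congrFun (congrFun hNt p) q
        simpa using this
      rw [h2, neg_smul]
    have h2 : M = (1 / 2 : ℝ) • (M + M) := by module
    rw [h2]
    nth_rw 1 [hMk]
    nth_rw 1 [h1]
    rw [← sub_eq_add_neg, ← Finset.sum_sub_distrib, Finset.smul_sum, Finset.smul_sum]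
    refine Finset.sum_congr rfl fun p _ => ?_
    rw [← Finset.sum_sub_distrib, Finset.smul_sum, Finset.smul_sum]
    refine Finset.sum_congr rfl fun q _ => ?_
    simp only [k, symProd, wedge, sub_eq_add_neg, ← neg_one_smul ℝ (outer _ _),
      ← neg_one_smul ℝ (Matrix.single _ _ _), Matrix.add_kronecker, Matrix.kronecker_add,
      Matrix.smul_kronecker, Matrix.kronecker_smul]
    module
  rw [hMk']
  refine Q.smul_mem _ (sum_mem fun p _ => sum_mem fun q _ => Q.smul_mem _ (add_mem ?_ ?_))
  · exact sym _ _ _ (anti _ _)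
  · by_cases h : p.2 = q.2
    · rw [h]
      exact diag _ _ _
    · exact offdiag _ _ _ _ h

theorem range_eq_skewAdjoint
    {ρ : K →ₗ⁅ℝ⁆ Matrix (Fin 10 × Fin 32) (Fin 10 × Fin 32) ℝ} (hρ : IsSpinThreeHalves Γ ρ) :
    ρ.range = skewAdjointMatricesLieSubalgebra gram := by
  refine le_antisymm (range_le fun i => ?_) (skewAdjoint_le hΓ fun i => ?_)
  · rw [hρ]
    exact spinGenerator_mem_skewAdjoint hΓ i
  · rw [← hρ]
    exact LieHom.mem_range_self ρ (x i)

end Range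

/-! ### An orthonormal frame for the DeWitt metric -/

/-- Eighteen times the components of an orthonormal frame. -/
def frameInt (a i : Fin 10) : ℤ :=
  if i = 9 then (if a = 9 then -6 else 3)
  else (if a = i then 18 else 0) + if a = 9 then -6 else -1

/-- The signs of the squared lengths of the frame vectors. -/
def frameSign (i : Fin 10) : ℤ := if i = 9 then -1 else 1

/-- An orthonormal frame for the metric `G_{ab}`. -/
def frame : Matrix (Fin 10) (Fin 10) ℝ := Matrix.of fun a i => (1 / 18) * (frameInt a i : ℝ)

/-- Clearing denominators (`324 = 18²`) turns orthonormality into a finite check over the integers.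
-/
theorem frame_orthonormal :
    frameᵀ * metricLower * frame = Matrix.diagonal fun i => (frameSign i : ℝ) := by
  have h : ∀ i j, (∑ a, frameInt a i * frameInt a j) -
      (∑ a, frameInt a i) * ∑ a, frameInt a j = if i = j then 324 * frameSign i else 0 := by
    decide +kernel
  have h' : ∀ i j, (∑ a, (frameInt a i : ℝ) * frameInt a j) -
      (∑ a, (frameInt a i : ℝ)) * ∑ a, (frameInt a j : ℝ) =
        if i = j then 324 * (frameSign i : ℝ) else 0 := by
    intro i j
    exact_mod_cast congrArg (Int.cast : ℤ → ℝ) (h i j)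
  ext i j
  have h1 : (frameᵀ * metricLower * frame) i j = (1 / 324) *
      ((∑ a, (frameInt a i : ℝ) * frameInt a j) -
        (∑ a, (frameInt a i : ℝ)) * ∑ a, (frameInt a j : ℝ)) := by
    simp only [Matrix.mul_apply, Matrix.transpose_apply, frame, Matrix.of_apply, metricLower,
      mul_sub, Finset.sum_sub_distrib, sub_mul]
    simp only [mul_ite, mul_one, mul_zero, Finset.sum_ite_eq', Finset.mem_univ, if_true]
    have e1 : ∑ a, 1 / 18 * (frameInt a i : ℝ) * (1 / 18 * (frameInt a j : ℝ)) =
        1 / 324 * ∑ a, (frameInt a i : ℝ) * frameInt a j := by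
      rw [Finset.mul_sum]
      exact Finset.sum_congr rfl fun a _ => by ring
    rw [e1]
    simp only [← Finset.mul_sum]
    ring
  rw [h1, h', Matrix.diagonal_apply]
  split_ifs <;> ring

/-- The frame of vector-spinors attached to the orthonormal frame. -/
def spinorFrame : Matrix (Fin 10 × Fin 32) (Fin 10 × Fin 32) ℝ :=
  frame ⊗ₖ (1 : Matrix (Fin 32) (Fin 32) ℝ)

/-- The signs of the squared lengths of the vector-spinor frame. -/
def spinorSign (p : Fin 10 × Fin 32) : ℝ := frameSign p.1

theorem spinorFrame_orthonormal :
    spinorFrameᵀ * gram * spinorFrame = Matrix.diagonal spinorSign := by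
  rw [spinorFrame, gram, ← Matrix.kroneckerMap_transpose, ← Matrix.mul_kronecker_mul,
    ← Matrix.mul_kronecker_mul, frame_orthonormal, Matrix.transpose_one, mul_one, mul_one,
    ← Matrix.diagonal_one, Matrix.diagonal_kronecker_diagonal]
  simp [spinorSign]

theorem spinorSign_mul_self (p : Fin 10 × Fin 32) : spinorSign p * spinorSign p = 1 := by
  unfold spinorSign frameSign
  split_ifs <;> norm_num

/-- The inverse of the vector-spinor frame. -/
def spinorCoframe : Matrix (Fin 10 × Fin 32) (Fin 10 × Fin 32) ℝ :=
  Matrix.diagonal spinorSign * (spinorFrameᵀ * gram)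

theorem spinorCoframe_mul_spinorFrame : spinorCoframe * spinorFrame = 1 := by
  rw [spinorCoframe, mul_assoc, spinorFrame_orthonormal, Matrix.diagonal_mul_diagonal]
  simp only [spinorSign_mul_self, Matrix.diagonal_one]

theorem form_apply (φ ψ : Fin 10 × Fin 32 → ℝ) : form φ ψ = φ ⬝ᵥ gram *ᵥ ψ :=
  Matrix.toBilin'_apply' _ _ _

theorem form_comm (φ ψ : Fin 10 × Fin 32 → ℝ) : form φ ψ = form ψ φ := by
  rw [form_apply, form_apply, Matrix.dotProduct_mulVec, ← Matrix.mulVec_transpose, gram_transpose,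
    dotProduct_comm]

theorem form_equivalent : form.toQuadraticMap.Equivalent
    (QuadraticMap.weightedSumSquares ℝ spinorSign) := by
  let e : (Fin 10 × Fin 32 → ℝ) ≃ₗ[ℝ] (Fin 10 × Fin 32 → ℝ) :=
    Matrix.toLin'OfInv (M := spinorCoframe) (M' := spinorFrame)
      spinorCoframe_mul_spinorFrame (mul_eq_one_comm.1 spinorCoframe_mul_spinorFrame)
  refine QuadraticMap.Equivalent.symm ⟨⟨e, fun φ => ?_⟩⟩
  have he : e φ = spinorFrame *ᵥ φ := by simp [e, Matrix.toLin'OfInv]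
  change form.toQuadraticMap (e φ) = _
  rw [he, LinearMap.BilinMap.toQuadraticMap_apply, form_apply, Matrix.mulVec_mulVec,
    ← Matrix.vecMul_transpose, ← Matrix.dotProduct_mulVec, Matrix.mulVec_mulVec, ← mul_assoc,
    spinorFrame_orthonormal, QuadraticMap.weightedSumSquares_apply]
  simp only [dotProduct, Matrix.mulVec_diagonal, smul_eq_mul]
  exact Finset.sum_congr rfl fun p _ => by ring

theorem spinorSign_pos_iff (p : Fin 10 × Fin 32) : 0 < spinorSign p ↔ p.1 ≠ 9 := by
  unfold spinorSign frameSign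
  split_ifs with h <;> simp [h]

theorem spinorSign_neg_iff (p : Fin 10 × Fin 32) : spinorSign p < 0 ↔ p.1 = 9 := by
  unfold spinorSign frameSign
  split_ifs with h <;> simp [h]

theorem sigPos_form : sigPos form.toQuadraticMap = 288 := by
  rw [QuadraticForm.sigPos_of_equiv_weightedSumSquares form_equivalent]
  have h : {p : Fin 10 × Fin 32 | 0 < spinorSign p} =
      (({9}ᶜ : Finset (Fin 10)) ×ˢ (Finset.univ : Finset (Fin 32)) : Finset _) := by
    ext p
    simp [spinorSign_pos_iff]
  rw [h, Set.ncard_coe_finset, Finset.card_product, Finset.card_compl]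
  simp

theorem sigNeg_form : sigNeg form.toQuadraticMap = 32 := by
  rw [QuadraticForm.sigNeg_of_equiv_weightedSumSquares form_equivalent]
  have h : {p : Fin 10 × Fin 32 | spinorSign p < 0} =
      (({9} : Finset (Fin 10)) ×ˢ (Finset.univ : Finset (Fin 32)) : Finset _) := by
    ext ⟨a, s⟩
    simp [spinorSign_neg_iff, eq_comm]
  rw [h, Set.ncard_coe_finset, Finset.card_product]
  simp

/-- The splitting of the vector-spinor frame into its positive and negative parts. -/
def signSplitting : Fin 10 × Fin 32 ≃ Fin 288 ⊕ Fin 32 :=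
  ((finSumFinEquiv (m := 9) (n := 1)).symm.prodCongr (Equiv.refl (Fin 32))).trans
    ((Equiv.sumProdDistrib (Fin 9) (Fin 1) (Fin 32)).trans
      (Equiv.sumCongr (finProdFinEquiv (m := 9) (n := 32)) (finProdFinEquiv (m := 1) (n := 32))))

theorem elim_signSplitting (p : Fin 10 × Fin 32) :
    Sum.elim (fun _ => 1) (fun _ => -1) (signSplitting p) = spinorSign p := by
  obtain ⟨a, s⟩ := p
  obtain ⟨q, rfl⟩ := (finSumFinEquiv (m := 9) (n := 1)).surjective a
  rcases q with q | q
  · have h : (finSumFinEquiv (Sum.inl q) : Fin (9 + 1)) ≠ 9 := by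
      rw [finSumFinEquiv_apply_left]
      exact q.castSucc_lt_last.ne
    have h2 : signSplitting (finSumFinEquiv (n := 1) (Sum.inl q), s) =
        Sum.inl (finProdFinEquiv (m := 9) (q, s)) := by
      simp [signSplitting]
    rw [h2]
    simp [spinorSign, frameSign, h]
  · have h : (finSumFinEquiv (Sum.inr q) : Fin (9 + 1)) = 9 := by
      rw [Subsingleton.elim q 0]
      rfl
    have h2 : signSplitting (finSumFinEquiv (m := 9) (Sum.inr q), s) =
        Sum.inr (finProdFinEquiv (m := 1) (q, s)) := by
      simp only [signSplitting, Equiv.trans_apply, Equiv.prodCongr_apply, Prod.map_apply,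
        Equiv.symm_apply_apply]
      rfl
    rw [h2]
    simp only [spinorSign, frameSign, h]
    simp

/-- Congruence by the frame makes the Gram matrix diagonal with entries `±1`, and reindexing puts
the positive entries first. -/
theorem nonempty_equiv_so : Nonempty (skewAdjointMatricesLieSubalgebra gram ≃ₗ⁅ℝ⁆
    LieAlgebra.Orthogonal.so' (Fin 288) (Fin 32) ℝ) := by
  have e1 := skewAdjointMatricesLieSubalgebraEquiv gram spinorFrame
    ⟨spinorCoframe, spinorCoframe_mul_spinorFrame,
      mul_eq_one_comm.1 spinorCoframe_mul_spinorFrame⟩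
  have e2 := skewAdjointMatricesLieSubalgebraEquivTranspose (spinorFrameᵀ * gram * spinorFrame)
    (Matrix.reindexAlgEquiv ℝ ℝ signSplitting) fun A => by simp
  have h : Matrix.reindexAlgEquiv ℝ ℝ signSplitting (spinorFrameᵀ * gram * spinorFrame) =
      LieAlgebra.Orthogonal.indefiniteDiagonal (Fin 288) (Fin 32) ℝ := by
    rw [spinorFrame_orthonormal, LieAlgebra.Orthogonal.indefiniteDiagonal]
    ext p q
    rw [Matrix.coe_reindexAlgEquiv, Matrix.reindex_apply, Matrix.submatrix_apply,
      Matrix.diagonal_apply, Matrix.diagonal_apply, ← elim_signSplitting,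
      Equiv.apply_symm_apply]
    simp only [EmbeddingLike.apply_eq_iff_eq]
  rw [h] at e2
  exact ⟨e1.trans e2⟩

/-! ### Non-compactness -/

/-- Invariance applied to `w, y, y` reads `2 β(y, y) = 0`. -/
theorem not_hasInvariantNegDefForm {L : Type*} [LieRing L] [LieAlgebra ℝ L] {w y : L}
    (hy : y ≠ 0) (h : ⁅w, y⁆ = y) : ¬ HasInvariantNegDefForm L := by
  rintro ⟨β, -, hinv, hneg⟩
  have h1 := hinv w y y
  rw [h] at h1
  have h2 := hneg y hy
  linarith

theorem exists_hyperbolic : ∃ v w : Matrix (Fin 10) (Fin 10) ℝ,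
    (∃ p q, v = wedge p q) ∧ (∃ p q, w = wedge p q) ∧ w ≠ 0 ∧ v * w - w * v = w := by
  -- Here `q` is null, `ip p q = -1`, and `r` is orthogonal to both. So `p ∧ q` is a boost that
  -- scales the null rotation `q ∧ r` with eigenvalue `1`.
  let p : Fin 10 → ℝ := 1 - unit 9
  let q : Fin 10 → ℝ := 1 - unit 0
  let r : Fin 10 → ℝ := unit 1
  have hone : ip 1 1 = -10 / 9 := by
    rw [ip_eq]
    simp
    norm_num
  have hunit : ∀ a, ip (unit a) 1 = -1 / 9 := fun a => by
    rw [ip_eq]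
    simp
    norm_num
  have hqq : ip q q = 0 := by
    simp only [q, sub_eq_add_neg, ip_add_left, ip_add_right, ip_neg_left, ip_neg_right,
      ip_comm 1 (unit _), hone, hunit, ip_unit]
    norm_num
  have hpq : ip p q = -1 := by
    simp only [p, q, sub_eq_add_neg, ip_add_left, ip_add_right, ip_neg_left, ip_neg_right,
      ip_comm 1 (unit _), hone, hunit, ip_unit]
    norm_num
    decide
  have hpr : ip p r = 0 := by
    simp only [p, r, sub_eq_add_neg, ip_add_left, ip_neg_left,
      ip_comm 1 (unit _), hunit, ip_unit]
    norm_num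
    decide
  have hqr : ip q r = 0 := by
    simp only [q, r, sub_eq_add_neg, ip_add_left, ip_neg_left,
      ip_comm 1 (unit _), hunit, ip_unit]
    norm_num
  refine ⟨wedge p q, wedge q r, ⟨p, q, rfl⟩, ⟨q, r, rfl⟩, fun h => ?_, ?_⟩
  · have h1 : metricLower * wedge q r = 0 := by rw [h, mul_zero]
    rw [wedge, mul_sub, metricLower_mul_outer, metricLower_mul_outer] at h1
    have h2 := congrFun (congrFun h1 2) 1
    simp [Matrix.vecMulVec_apply, q, r] at h2
  · have h1 := lie_wedge_outer p q q r
    have h2 := lie_wedge_outer p q r q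
    rw [hqq, hpq, hpr, hqr] at h1 h2
    have h3 : wedge p q * wedge q r - wedge q r * wedge p q =
        (wedge p q * outer q r - outer q r * wedge p q) -
        (wedge p q * outer r q - outer r q * wedge p q) := by
      rw [wedge.eq_1 q r, mul_sub, sub_mul]
      abel
    rw [h3, h1, h2, wedge.eq_1 q r]
    module

theorem not_hasInvariantNegDefForm_quotient {Γ : Fin 10 → Matrix (Fin 32) (Fin 32) ℝ}
    (hΓ : IsGammaSystem Γ) {ρ : K →ₗ⁅ℝ⁆ Matrix (Fin 10 × Fin 32) (Fin 10 × Fin 32) ℝ}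
    (hρ : IsSpinThreeHalves Γ ρ) : ¬ HasInvariantNegDefForm (K ⧸ ρ.ker) := by
  obtain ⟨v, w, ⟨p, q, hv⟩, ⟨p', q', hw⟩, hw0, hvw⟩ := exists_hyperbolic
  have hQ : ∀ i, spinGenerator Γ (simpleRoot i) ∈ ρ.range := fun i => by
    rw [← hρ]
    exact LieHom.mem_range_self ρ (x i)
  have hvm : v ⊗ₖ (1 : Matrix (Fin 32) (Fin 32) ℝ) ∈ ρ.range := by
    rw [hv]
    exact wedge_mem hΓ hQ p q
  have hwm : w ⊗ₖ (1 : Matrix (Fin 32) (Fin 32) ℝ) ∈ ρ.range := by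
    rw [hw]
    exact wedge_mem hΓ hQ p' q'
  let E := ρ.quotKerEquivRange
  refine not_hasInvariantNegDefForm (w := E.symm ⟨_, hvm⟩) (y := E.symm ⟨_, hwm⟩) ?_ ?_
  · intro h
    have h1 : (⟨_, hwm⟩ : ρ.range) = 0 := by
      rw [← E.apply_symm_apply ⟨_, hwm⟩, h, map_zero]
    have h2 : w ⊗ₖ (1 : Matrix (Fin 32) (Fin 32) ℝ) = 0 := congrArg Subtype.val h1
    refine hw0 (Matrix.ext fun a b => ?_)
    simpa using congrFun (congrFun h2 (a, 0)) (b, 0)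
  · rw [← LieEquiv.map_lie]
    congr 1
    apply Subtype.ext
    change ⁅v ⊗ₖ (1 : Matrix (Fin 32) (Fin 32) ℝ), w ⊗ₖ (1 : Matrix (Fin 32) (Fin 32) ℝ)⁆ =
      w ⊗ₖ (1 : Matrix (Fin 32) (Fin 32) ℝ)
    rw [lie_kronecker_of_comm rfl, hvw, mul_one]

/-! ### Existence of gamma matrices -/

/-- The real Pauli matrices, together with the identity. -/
def pauli : Fin 4 → Matrix (Fin 2) (Fin 2) ℝ :=
  ![1, !![0, 1; 1, 0], !![1, 0; 0, -1], !![0, 1; -1, 0]]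

/-- The commutation sign of two Pauli matrices. -/
def pauliSwap (a b : Fin 4) : ℤ := if a = 0 ∨ b = 0 ∨ a = b then 1 else -1

/-- The symmetry sign of a Pauli matrix. -/
def pauliSign (a : Fin 4) : ℤ := if a = 3 then -1 else 1

theorem pauli_mul_pauli (a b : Fin 4) :
    pauli a * pauli b = (pauliSwap a b : ℝ) • (pauli b * pauli a) := by
  fin_cases a <;> fin_cases b <;> simp [pauli, pauliSwap]

theorem pauli_mul_self (a : Fin 4) : pauli a * pauli a = (pauliSign a : ℝ) • 1 := by
  fin_cases a <;> simp [pauli, pauliSign, Matrix.one_fin_two]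

theorem pauli_transpose (a : Fin 4) : (pauli a)ᵀ = (pauliSign a : ℝ) • pauli a := by
  fin_cases a <;> simp [pauli, pauliSign, ← Matrix.ext_iff, Fin.forall_fin_two]

/-- Tensor products of Pauli matrices. -/
def pauliString (w : Fin 5 → Fin 4) :
    Matrix (Fin 2 × Fin 2 × Fin 2 × Fin 2 × Fin 2) (Fin 2 × Fin 2 × Fin 2 × Fin 2 × Fin 2) ℝ :=
  pauli (w 0) ⊗ₖ (pauli (w 1) ⊗ₖ (pauli (w 2) ⊗ₖ (pauli (w 3) ⊗ₖ pauli (w 4))))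

theorem pauliString_mul_pauliString (w w' : Fin 5 → Fin 4) :
    pauliString w * pauliString w' =
      ((∏ k, pauliSwap (w k) (w' k) : ℤ) : ℝ) • (pauliString w' * pauliString w) := by
  simp only [pauliString, ← Matrix.mul_kronecker_mul]
  rw [pauli_mul_pauli (w 0), pauli_mul_pauli (w 1), pauli_mul_pauli (w 2), pauli_mul_pauli (w 3),
    pauli_mul_pauli (w 4)]
  simp only [Matrix.smul_kronecker, Matrix.kronecker_smul, smul_smul, Fin.prod_univ_five]
  push_cast
  ring_nf

theorem pauliString_mul_self (w : Fin 5 → Fin 4) :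
    pauliString w * pauliString w = ((∏ k, pauliSign (w k) : ℤ) : ℝ) • 1 := by
  simp only [pauliString, ← Matrix.mul_kronecker_mul, pauli_mul_self, Matrix.smul_kronecker,
    Matrix.kronecker_smul, smul_smul, Matrix.one_kronecker_one, Fin.prod_univ_five]
  push_cast
  ring_nf

theorem pauliString_transpose (w : Fin 5 → Fin 4) :
    (pauliString w)ᵀ = ((∏ k, pauliSign (w k) : ℤ) : ℝ) • pauliString w := by
  simp only [pauliString, ← Matrix.kroneckerMap_transpose, pauli_transpose, Matrix.smul_kronecker,
    Matrix.kronecker_smul, smul_smul, Fin.prod_univ_five]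
  push_cast
  ring_nf

/-- Ten anticommuting symmetric strings of Pauli matrices. -/
def gammaString : Fin 10 → Fin 5 → Fin 4 :=
  ![![0, 0, 0, 0, 1], ![0, 0, 0, 0, 2], ![0, 0, 0, 3, 3], ![0, 0, 3, 1, 3], ![0, 1, 3, 2, 3],
    ![0, 2, 3, 2, 3], ![0, 3, 0, 2, 3], ![0, 3, 1, 1, 3], ![1, 3, 2, 1, 3], ![2, 3, 2, 1, 3]]

/-- Two Pauli strings commute up to the product of their letterwise signs, and one sign product
governs both the square and the transpose of a string. The Clifford relations and symmetry thus
reduce to finite sign checks. -/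
theorem exists_isGammaSystem :
    ∃ Γ : Fin 10 → Matrix (Fin 32) (Fin 32) ℝ, IsGammaSystem Γ := by
  let σ : Fin 2 × Fin 2 × Fin 2 × Fin 2 × Fin 2 ≃ Fin 32 := Fintype.equivFinOfCardEq (by simp)
  let e := Matrix.reindexAlgEquiv ℝ ℝ σ
  have hsign : ∀ a, ∏ k, pauliSign (gammaString a k) = 1 := by decide +kernel
  have hswap : ∀ a b, a ≠ b → ∏ k, pauliSwap (gammaString a k) (gammaString b k) = -1 := by
    decide +kernel
  refine ⟨fun a => e (pauliString (gammaString a)), fun a b => ?_, fun a => ?_⟩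
  · split_ifs with h
    · subst h
      rw [← map_mul, pauliString_mul_self, hsign, Int.cast_one, one_smul, map_one,
        one_add_one_eq_two]
    · rw [← map_mul, pauliString_mul_pauliString, hswap a b h, ← map_mul, Int.cast_neg,
        Int.cast_one, neg_one_smul, map_neg, neg_add_cancel]
  · change (Matrix.reindex σ σ _)ᵀ = Matrix.reindex σ σ _
    rw [Matrix.transpose_reindex, pauliString_transpose, hsign, Int.cast_one, one_smul]

end E10

end

theorem mainTheorem5 :
    (∃ Γ : Fin 10 → Matrix (Fin 32) (Fin 32) ℝ, E10.IsGammaSystem Γ) ∧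
    ∀ Γ : Fin 10 → Matrix (Fin 32) (Fin 32) ℝ, E10.IsGammaSystem Γ →
      (∃! ρ : E10.K →ₗ⁅ℝ⁆ Matrix (Fin 10 × Fin 32) (Fin 10 × Fin 32) ℝ,
        E10.IsSpinThreeHalves Γ ρ) ∧
      ∀ ρ : E10.K →ₗ⁅ℝ⁆ Matrix (Fin 10 × Fin 32) (Fin 10 × Fin 32) ℝ,
        E10.IsSpinThreeHalves Γ ρ →
        (∀ φ ψ, E10.form φ ψ = E10.form ψ φ) ∧
        sigPos E10.form.toQuadraticMap = 288 ∧
        sigNeg E10.form.toQuadraticMap = 32 ∧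
        (∀ (y : E10.K) (φ ψ : Fin 10 × Fin 32 → ℝ),
          E10.form ((ρ y).mulVec φ) ψ + E10.form φ ((ρ y).mulVec ψ) = 0) ∧
        (∀ M : Matrix (Fin 10 × Fin 32) (Fin 10 × Fin 32) ℝ,
          M ∈ ρ.range ↔ ∀ φ ψ, E10.form (M.mulVec φ) ψ + E10.form φ (M.mulVec ψ) = 0) ∧
        Nonempty ((E10.K ⧸ ρ.ker) ≃ₗ⁅ℝ⁆ LieAlgebra.Orthogonal.so' (Fin 288) (Fin 32) ℝ) ∧
        ¬ HasInvariantNegDefForm (E10.K ⧸ ρ.ker) := by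
  refine ⟨E10.exists_isGammaSystem, fun Γ hΓ => ⟨?_, fun ρ hρ => ?_⟩⟩
  · obtain ⟨ρ, hρ⟩ := E10.exists_isSpinThreeHalves hΓ
    exact ⟨ρ, hρ, fun ρ' hρ' => E10.lieHom_ext fun i => (hρ' i).trans (hρ i).symm⟩
  · have hrange := E10.range_eq_skewAdjoint hΓ hρ
    have hmem : ∀ M : Matrix (Fin 10 × Fin 32) (Fin 10 × Fin 32) ℝ,
        M ∈ ρ.range ↔ ∀ φ ψ, E10.form (M.mulVec φ) ψ + E10.form φ (M.mulVec ψ) = 0 := fun M => by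
      rw [hrange, E10.mem_skewAdjoint_iff_form]
    refine ⟨E10.form_comm, E10.sigPos_form, E10.sigNeg_form,
      fun y => (hmem (ρ y)).1 (LieHom.mem_range_self ρ y), hmem, ?_,
      E10.not_hasInvariantNegDefForm_quotient hΓ hρ⟩
    obtain ⟨e⟩ := E10.nonempty_equiv_so
    exact ⟨(ρ.quotKerEquivRange.trans (LieEquiv.ofEq _ _ (congrArg _ hrange))).trans e⟩
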